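/- Let $\Omega_1\subset\mathbb R^2$ be a convex polygonal domain, i.e. a non-empty (bounded or unbounded) intersection of finitely many open half-planes, with $N\ge 1$ vertices $B_1,\dots,B_N$. Let $2\alpha_j$ with $\alpha_j\in(0,\frac{\pi}{2})$ be the opening of the corner of $\Omega_1$ at $B_j$, and put $\alpha:=\min_j\alpha_j$. For $L>0$ let $\Omega=\Omega_L:=L\Omega_1$, with vertices $A_j:=LB_j$. Fix $\beta>0$ and let $H$ be the Robin Laplacian in $L^2(\Omega;\mathbb R)$, i.e. the operator associated with the bilinear form $$h(u,v)=\int_\Omega \nabla u\cdot\nabla v\,dx-\beta\int_{\partial\Omega}uv\,ds,\qquad u,v\in H^1(\Omega),$$ where $ds$ is arc length. Choose a constant $b>0$ such that $|B_j|\le b$ for all $j$, and define $$\Phi(x):=\beta\,\min\Big\{\min_{1\le j\le N}\cot\alpha_j\,|x-A_j|,\; bL\Big\},\qquad x\in\Omega.$$ (If $\Omega_1$ is bounded, $b$ may be chosen so large that the truncation at $bL$ has no effect.) Let $\lambda=\lambda(L)>0$ satisfy $\lim_{L\to+\infty}\lambda(L)=0$. Then for every $\varepsilon\in(0,1)$ there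 exist $C_\varepsilon>0$ and $L_\varepsilon>0$ such that for every $L\ge L_\varepsilon$, every eigenvalue $E$ of $H$ with $$E\le-\frac{\beta^2}{\sin^2\alpha}+\lambda(L),$$ and every associated eigenfunction $u$ with $\|u\|_{L^2(\Omega)}=1$, one has $e^{(1-\varepsilon)\Phi}u\in H^1(\Omega)$ and $$\big\|e^{(1-\varepsilon)\Phi}u\big\|_{H^1(\Omega)}\le C_\varepsilon\, e^{\varepsilon L},\qquad\text{where } \|w\|_{H^1(\Omega)}^2=\int_\Omega|\nabla w|^2\,dx+\int_\Omega w^2\,dx .$$ -/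

import Mathlib

open Set Filter Topology MeasureTheory
open scoped ContDiff Pointwise

noncomputable section

namespace RobinPolygon

/-- The Euclidean plane. -/
abbrev Plane : Type := EuclideanSpace ℝ (Fin 2)

/-- The convex polygonal domains (bounded or not): non-empty intersections of finitely many
open half-planes. -/
def IsConvexPolygonalDomain (Ω : Set Plane) : Prop :=
  Ω.Nonempty ∧ ∃ (m : ℕ) (n : Fin m → Plane) (c : Fin m → ℝ),
    (∀ i, n i ≠ 0) ∧ Ω = {x | ∀ i, inner ℝ (n i) x < c i}

/-- The vertices of a convex polygonal domain: the extreme points of its closure. -/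
def vertices (Ω : Set Plane) : Set Plane := extremePoints ℝ (closure Ω)

/-- The open infinite sector with vertex `P`, bisected by the unit vector `e`, of opening `2 * a`
(for `0 < a < π`): the points `x ≠ P` for which the angle between `x - P` and `e` is
less than `a`. -/
def sector (P e : Plane) (a : ℝ) : Set Plane :=
  {x | ‖x - P‖ * Real.cos a < inner ℝ e (x - P)}

/-- Near the point `P`, the set `Ω` coincides with a sector of vertex `P` and opening `2 * a`. -/
def HasCorner (Ω : Set Plane) (P : Plane) (a : ℝ) : Prop :=
  ∃ (e : Plane) (r : ℝ), ‖e‖ = 1 ∧ 0 < r ∧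
    Ω ∩ Metric.ball P r = sector P e a ∩ Metric.ball P r

/-- Arc length on the boundary of `Ω`. -/
def boundaryMeasure (Ω : Set Plane) : Measure Plane :=
  (Measure.hausdorffMeasure 1).restrict (frontier Ω)

/-- `u` belongs to `H¹(Ω)` (real-valued) and `G` is its weak gradient. -/
structure HasWeakGradient (Ω : Set Plane) (u : Plane → ℝ) (G : Plane → Plane) : Prop where
  memLp_fun : MemLp u 2 (volume.restrict Ω)
  memLp_grad : MemLp G 2 (volume.restrict Ω)
  integral_eq : ∀ φ : Plane → ℝ, ContDiff ℝ ∞ φ → HasCompactSupport φ → tsupport φ ⊆ Ω →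
    ∀ e : Plane, ∫ x in Ω, u x * fderiv ℝ φ x e = -∫ x in Ω, inner ℝ (G x) e * φ x

/-- `u` belongs to `H¹(Ω)`, `G` is its weak gradient, and `g ∈ L²(∂Ω)` is its boundary trace:
the trace map is the extension by continuity, from the `H¹(Ω)` norm to the `L²(∂Ω)` norm, of the
restriction to `∂Ω` of smooth compactly supported functions on the plane. -/
structure HasTrace (Ω : Set Plane) (u : Plane → ℝ) (G : Plane → Plane) (g : Plane → ℝ) :
    Prop where
  weakGradient : HasWeakGradient Ω u G
  memLp_trace : MemLp g 2 (boundaryMeasure Ω)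
  exists_approx : ∃ φ : ℕ → Plane → ℝ,
    (∀ k, ContDiff ℝ ∞ (φ k) ∧ HasCompactSupport (φ k)) ∧
    Tendsto (fun k => eLpNorm (fun x => φ k x - u x) 2 (volume.restrict Ω)) atTop (𝓝 0) ∧
    Tendsto (fun k => eLpNorm (fun x => gradient (φ k) x - G x) 2 (volume.restrict Ω))
      atTop (𝓝 0) ∧
    Tendsto (fun k => eLpNorm (fun x => φ k x - g x) 2 (boundaryMeasure Ω)) atTop (𝓝 0)

/-- The Robin form `∫_Ω ∇u · ∇v dx - β ∫_∂Ω u v ds`, where `G`, `G'` are the weak gradients of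
`u`, `v` and `g`, `g'` are their boundary traces. -/
def robinForm (Ω : Set Plane) (β : ℝ) (G : Plane → Plane) (g : Plane → ℝ)
    (G' : Plane → Plane) (g' : Plane → ℝ) : ℝ :=
  (∫ x in Ω, inner ℝ (G x) (G' x)) - β * ∫ x, g x * g' x ∂(boundaryMeasure Ω)

/-- The graph of the Robin Laplacian `H(Ω, β)`, the operator in `L²(Ω; ℝ)` associated with the
Robin form on `H¹(Ω)`: `u` is in the domain of the operator and is mapped to `f`. -/
def IsRobinLaplacian (Ω : Set Plane) (β : ℝ) (u f : Plane → ℝ) : Prop :=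
  MemLp f 2 (volume.restrict Ω) ∧
  ∃ (G : Plane → Plane) (g : Plane → ℝ), HasTrace Ω u G g ∧
    ∀ (v : Plane → ℝ) (G' : Plane → Plane) (g' : Plane → ℝ), HasTrace Ω v G' g' →
      robinForm Ω β G g G' g' = ∫ x in Ω, f x * v x

/-- `u` is an eigenfunction of `H(Ω, β)` for the eigenvalue `E`, normalized in `L²(Ω)`. -/
def IsNormalizedEigenfunction (Ω : Set Plane) (β E : ℝ) (u : Plane → ℝ) : Prop :=
  IsRobinLaplacian Ω β u (fun x => E * u x) ∧ ∫ x in Ω, u x ^ 2 = 1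

/-- The `H¹(Ω)` norm of a function `w` with weak gradient `G`. -/
def h1Norm (Ω : Set Plane) (w : Plane → ℝ) (G : Plane → Plane) : ℝ :=
  Real.sqrt ((∫ x in Ω, ‖G x‖ ^ 2) + ∫ x in Ω, w x ^ 2)

/-- The weight `Φ(x) = β min {min_j cot α_j |x - A_j|, b L}`, where `A_j = L B_j`. -/
def agmonWeight {N : ℕ} (B : Fin N → Plane) (α : Fin N → ℝ) (β b L : ℝ) (x : Plane) : ℝ :=
  β * min (⨅ j, Real.cot (α j) * ‖x - L • B j‖) (b * L)

end RobinPolygon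

end

/-! This is an Agmon estimate, driven by a lower bound for the Robin form that is sharp away from
the corners.

The lower bound comes from a vector field. If `V` has outward normal component at least `β` on the
boundary, the divergence theorem applied to `φ² V` and Young's inequality give β ∫_∂Ω φ² ≤ ∫ |∇φ|² +
∫ (|V|² + div V) φ² (`quadratic_le_of_vectorField`). On a polygon such a field exists with `|V| ≤ β`
outside small discs around the vertices: near the interior of a side take `β` times the normal, cut
off with the distance to the side, and near a vertex add a large multiple of `x - p` with `p` an
interior point (`exists_vectorField`). Dilating by `L` leaves the size of `V` unchanged and divides
its derivatives by `L`. So the form dominates `-(β² + C/L)`, up to a further bounded loss on discs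
of radius `δ L` around the vertices (`exists_robin_bound`). Half of the Dirichlet integral can be
kept at the price of a worse constant everywhere.

Testing the eigenvalue equation with `e^{2F} u` shows that the form at `e^F u` equals ∫ (E + |∇F|²)
e^{2F} u² (`agmon_identity`). Let κ be the cotangent of the smallest half-angle. The weight `(1 -
ε)Φ` has Lipschitz constant `(1 - ε)βκ`, and β²/sin²α = β² + (βκ)². Hence `E + |∇F|² + β² + C/L` is
at most a fixed negative number for large `L`. Comparison with the lower bound leaves only the
discs, where Φ ≤ βκδL, which is `ε L` for the chosen `δ`. This bounds the `L²` norm of `e^F u`, and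
the second form inequality then bounds the gradient (`weighted_estimate`).

Φ is only Lipschitz, whereas test functions must be limits of smooth functions up to the boundary.
The argument is therefore run with a mollified weight having the same Lipschitz constant and within
distance 1 of Φ, and the estimate is transferred to Φ at the end (`h1Norm_exp_mul_le`). -/

namespace RobinPolygon

/-! ### Passing to the limit in L² -/

section LTwo

variable {X : Type*} [MeasurableSpace X] {μ : Measure X}

theorem integrable_inner_of_memLp {F : Type*} [NormedAddCommGroup F]
    [InnerProductSpace ℝ F] {f g : X → F} (hf : MemLp f 2 μ) (hg : MemLp g 2 μ) :
    Integrable (fun x => inner ℝ (f x) (g x)) μ :=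
  (hf.norm.integrable_mul hg.norm).mono' (hf.1.inner hg.1)
    (Eventually.of_forall fun _ => norm_inner_le_norm _ _)

theorem eventually_memLp_of_tendsto_eLpNorm {F : Type*} [NormedAddCommGroup F]
    {f : ℕ → X → F} {f₀ : X → F} (hfm : ∀ k, AEStronglyMeasurable (f k) μ)
    (hf₀ : MemLp f₀ 2 μ)
    (hf : Tendsto (fun k => eLpNorm (fun x => f k x - f₀ x) 2 μ) atTop (𝓝 0)) :
    ∀ᶠ k in atTop, MemLp (f k) 2 μ := by
  filter_upwards [hf.eventually_lt_const (zero_lt_one)] with k hk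
  have h1 : MemLp (fun x => f k x - f₀ x) 2 μ :=
    ⟨(hfm k).sub hf₀.1, hk.trans ENNReal.one_lt_top⟩
  convert h1.add hf₀ using 1
  funext x
  simp

/-- The inner product of the Hilbert space L² is continuous. This is what carries identities and
inequalities from smooth approximants to H¹(Ω) and to traces. -/
theorem tendsto_integral_inner_of_tendsto_eLpNorm {F : Type*} [NormedAddCommGroup F]
    [InnerProductSpace ℝ F] {f g : ℕ → X → F} {f₀ g₀ : X → F}
    (hfm : ∀ k, AEStronglyMeasurable (f k) μ) (hf₀ : MemLp f₀ 2 μ)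
    (hf : Tendsto (fun k => eLpNorm (fun x => f k x - f₀ x) 2 μ) atTop (𝓝 0))
    (hgm : ∀ k, AEStronglyMeasurable (g k) μ) (hg₀ : MemLp g₀ 2 μ)
    (hg : Tendsto (fun k => eLpNorm (fun x => g k x - g₀ x) 2 μ) atTop (𝓝 0)) :
    Tendsto (fun k => ∫ x, inner ℝ (f k x) (g k x) ∂μ) atTop
      (𝓝 (∫ x, inner ℝ (f₀ x) (g₀ x) ∂μ)) := by
  obtain ⟨n, hn⟩ := eventually_atTop.1 ((eventually_memLp_of_tendsto_eLpNorm hfm hf₀ hf).and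
    (eventually_memLp_of_tendsto_eLpNorm hgm hg₀ hg))
  -- The first terms need not be square integrable; a shift of the index discards them.
  rw [← tendsto_add_atTop_iff_nat n] at hf hg ⊢
  have hfn : ∀ k, MemLp (f (k + n)) 2 μ := fun k => (hn _ (Nat.le_add_left _ _)).1
  have hgn : ∀ k, MemLp (g (k + n)) 2 μ := fun k => (hn _ (Nat.le_add_left _ _)).2
  have h1 := (Lp.tendsto_Lp_iff_tendsto_eLpNorm'' (fun k => f (k + n)) hfn f₀ hf₀).2 hf
  have h2 := (Lp.tendsto_Lp_iff_tendsto_eLpNorm'' (fun k => g (k + n)) hgn g₀ hg₀).2 hg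
  have key : ∀ (a b : X → F) (ha : MemLp a 2 μ) (hb : MemLp b 2 μ),
      inner ℝ (ha.toLp a) (hb.toLp b) = ∫ x, inner ℝ (a x) (b x) ∂μ := by
    intro a b ha hb
    rw [L2.inner_def]
    refine integral_congr_ae ?_
    filter_upwards [ha.coeFn_toLp, hb.coeFn_toLp] with x hx hy
    rw [hx, hy]
  have h3 := h1.inner (𝕜 := ℝ) h2
  simpa only [key] using h3

theorem tendsto_integral_mul_of_tendsto_eLpNorm {f g : ℕ → X → ℝ} {f₀ g₀ : X → ℝ}
    (hfm : ∀ k, AEStronglyMeasurable (f k) μ) (hf₀ : MemLp f₀ 2 μ)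
    (hf : Tendsto (fun k => eLpNorm (fun x => f k x - f₀ x) 2 μ) atTop (𝓝 0))
    (hgm : ∀ k, AEStronglyMeasurable (g k) μ) (hg₀ : MemLp g₀ 2 μ)
    (hg : Tendsto (fun k => eLpNorm (fun x => g k x - g₀ x) 2 μ) atTop (𝓝 0)) :
    Tendsto (fun k => ∫ x, f k x * g k x ∂μ) atTop (𝓝 (∫ x, f₀ x * g₀ x ∂μ)) := by
  simpa [mul_comm] using tendsto_integral_inner_of_tendsto_eLpNorm hfm hf₀ hf hgm hg₀ hg

theorem tendsto_eLpNorm_of_norm_le_mul {F F' : Type*} [NormedAddCommGroup F]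
    [NormedAddCommGroup F'] {f : ℕ → X → F} {g : ℕ → X → F'} {C : ℝ}
    (hfg : ∀ k x, ‖f k x‖ ≤ C * ‖g k x‖)
    (hg : Tendsto (fun k => eLpNorm (g k) 2 μ) atTop (𝓝 0)) :
    Tendsto (fun k => eLpNorm (f k) 2 μ) atTop (𝓝 0) := by
  have h1 : Tendsto (fun k => ENNReal.ofReal C * eLpNorm (g k) 2 μ) atTop (𝓝 0) := by
    simpa using ENNReal.Tendsto.const_mul hg (Or.inr ENNReal.ofReal_ne_top)
  exact tendsto_of_tendsto_of_tendsto_of_le_of_le tendsto_const_nhds h1 (fun _ => zero_le)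
    (fun k => eLpNorm_le_mul_eLpNorm_of_ae_le_mul (Eventually.of_forall (hfg k)) 2)

end LTwo

/-! ### Gradients and multiplication of H¹ functions by weights -/

theorem inner_gradient_eq_fderiv (f : Plane → ℝ) (x e : Plane) :
    inner ℝ (gradient f x) e = fderiv ℝ f x e := by
  rw [gradient, InnerProductSpace.toDual_symm_apply]

theorem norm_gradient_eq (f : Plane → ℝ) (x : Plane) : ‖gradient f x‖ = ‖fderiv ℝ f x‖ := by
  rw [gradient, LinearIsometryEquiv.norm_map]

theorem measurable_gradient (f : Plane → ℝ) : Measurable (gradient f) :=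
  (InnerProductSpace.toDual ℝ Plane).symm.continuous.measurable.comp (measurable_fderiv ℝ f)

theorem continuous_gradient {f : Plane → ℝ} (hf : ContDiff ℝ ∞ f) : Continuous (gradient f) :=
  (InnerProductSpace.toDual ℝ Plane).symm.continuous.comp (hf.continuous_fderiv (by simp))

theorem gradient_mul {f g : Plane → ℝ} {x : Plane} (hf : DifferentiableAt ℝ f x)
    (hg : DifferentiableAt ℝ g x) :
    gradient (fun y => f y * g y) x = f x • gradient g x + g x • gradient f x := by
  refine ext_inner_right ℝ fun e => ?_
  rw [inner_gradient_eq_fderiv, inner_add_left, inner_smul_left, inner_smul_left,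
    inner_gradient_eq_fderiv, inner_gradient_eq_fderiv, fderiv_fun_mul hf hg]
  simp

/-- Integration by parts for the product of a Lipschitz function and two smooth ones. -/
theorem integral_lipschitz_mul_fderiv {ζ : Plane → ℝ} {K : NNReal} (hζ : LipschitzWith K ζ)
    {φ ψ : Plane → ℝ} (hφ : ContDiff ℝ ∞ φ) (hφc : HasCompactSupport φ) (hψ : ContDiff ℝ ∞ ψ)
    (e : Plane) :
    ∫ x, ψ x * (ζ x * fderiv ℝ φ x e) =
      -∫ x, (inner ℝ (gradient ψ x) e * (ζ x * φ x) +
        ψ x * (inner ℝ (gradient ζ x) e * φ x)) := by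
  have hc : HasCompactSupport (fun x => ψ x * φ x) := hφc.mul_left
  have hs : ContDiff ℝ ∞ (fun x => ψ x * φ x) := hψ.mul hφ
  obtain ⟨D, hD⟩ := hs.lipschitzWith_of_hasCompactSupport hc (by simp)
  -- A Lipschitz function is differentiable almost everywhere, and its line derivative can be moved
  -- onto the compactly supported Lipschitz function `ψ φ`, with direction `-e`.
  have h := hζ.integral_lineDeriv_mul_eq (μ := volume) hD hc e
  have hζc := hζ.continuous
  have h1 : ∀ x, lineDeriv ℝ (fun x => ψ x * φ x) x (-e) * ζ x =
      -(ψ x * (ζ x * fderiv ℝ φ x e)) - inner ℝ (gradient ψ x) e * (ζ x * φ x) := by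
    intro x
    have d1 := (hφ.differentiable (by simp)) x
    have d2 := (hψ.differentiable (by simp)) x
    rw [(hs.differentiable (by simp) x).lineDeriv_eq_fderiv, fderiv_fun_mul d2 d1,
      inner_gradient_eq_fderiv]
    simp
    ring
  have h2 : ∀ᵐ x, lineDeriv ℝ ζ x e * (ψ x * φ x) =
      ψ x * (inner ℝ (gradient ζ x) e * φ x) := by
    filter_upwards [hζ.ae_differentiableAt (μ := volume)] with x hx
    rw [hx.lineDeriv_eq_fderiv, inner_gradient_eq_fderiv]
    ring
  rw [integral_congr_ae h2] at h
  simp_rw [h1] at h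
  have c1 : Continuous (fun x => fderiv ℝ φ x e) :=
    (hφ.continuous_fderiv (by simp)).clm_apply continuous_const
  have c2 : Continuous (fun x => inner ℝ (gradient ψ x) e) :=
    (continuous_gradient hψ).inner continuous_const
  have i1 : Integrable (fun x => ψ x * (ζ x * fderiv ℝ φ x e)) :=
    (hψ.continuous.mul (hζc.mul c1)).integrable_of_hasCompactSupport
      (((hφc.fderiv_apply (𝕜 := ℝ) e).mul_left).mul_left)
  have i2 : Integrable (fun x => inner ℝ (gradient ψ x) e * (ζ x * φ x)) :=
    (c2.mul (hζc.mul hφ.continuous)).integrable_of_hasCompactSupport ((hφc.mul_left).mul_left)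
  have i3 : Integrable (fun x => ψ x * (inner ℝ (gradient ζ x) e * φ x)) := by
    have : Integrable (fun x => ψ x * φ x) :=
      (hψ.continuous.mul hφ.continuous).integrable_of_hasCompactSupport hc
    refine (this.norm.const_mul (K * ‖e‖)).mono' ?_ ?_
    · exact (hψ.continuous.aestronglyMeasurable.mul
        (((measurable_gradient ζ).inner measurable_const).aestronglyMeasurable.mul
          hφ.continuous.aestronglyMeasurable))
    · refine Eventually.of_forall fun x => ?_
      have := norm_fderiv_le_of_lipschitz ℝ hζ (x₀ := x)
      have h4 : ‖inner ℝ (gradient ζ x) e‖ ≤ K * ‖e‖ := by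
        refine (norm_inner_le_norm _ _).trans ?_
        rw [norm_gradient_eq]
        gcongr
      rw [norm_mul, norm_mul, norm_mul]
      calc ‖ψ x‖ * (‖inner ℝ (gradient ζ x) e‖ * ‖φ x‖)
          ≤ ‖ψ x‖ * ((K * ‖e‖) * ‖φ x‖) := by gcongr
        _ = _ := by ring
  rw [integral_sub (f := fun x => -(ψ x * (ζ x * fderiv ℝ φ x e))) i1.neg i2, integral_neg] at h
  rw [integral_add i2 i3, h]
  ring

/-- The product of a function in `H¹(Ω)` which is approximable by smooth functions and a bounded
Lipschitz function. -/
theorem HasTrace.weakGradient_mul {Ω : Set Plane} {u : Plane → ℝ} {G : Plane → Plane}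
    {g : Plane → ℝ} (h : HasTrace Ω u G g) {ζ : Plane → ℝ} {K : NNReal}
    (hζ : LipschitzWith K ζ) {C : ℝ} (hC : ∀ x, |ζ x| ≤ C) :
    HasWeakGradient Ω (fun x => ζ x * u x) (fun x => ζ x • G x + u x • gradient ζ x) := by
  have hζm : AEStronglyMeasurable ζ (volume.restrict Ω) := hζ.continuous.aestronglyMeasurable
  have hgm : AEStronglyMeasurable (gradient ζ) (volume.restrict Ω) :=
    (measurable_gradient ζ).aestronglyMeasurable
  have hu := h.weakGradient.memLp_fun
  have hG := h.weakGradient.memLp_grad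
  have hgK : ∀ x, ‖gradient ζ x‖ ≤ K := fun x => by
    rw [norm_gradient_eq]; exact norm_fderiv_le_of_lipschitz ℝ hζ
  have m1 : MemLp (fun x => ζ x * u x) 2 (volume.restrict Ω) :=
    hu.of_le_mul (c := C) (hζm.mul hu.1) (Eventually.of_forall fun x => by
      rw [norm_mul]; exact mul_le_mul_of_nonneg_right (hC x) (norm_nonneg _))
  have m2 : MemLp (fun x => ζ x • G x) 2 (volume.restrict Ω) :=
    hG.of_le_mul (c := C) (hζm.smul hG.1) (Eventually.of_forall fun x => by
      rw [norm_smul]; exact mul_le_mul_of_nonneg_right (hC x) (norm_nonneg _))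
  have m3 : MemLp (fun x => u x • gradient ζ x) 2 (volume.restrict Ω) :=
    hu.of_le_mul (c := K) (hu.1.smul hgm) (Eventually.of_forall fun x => by
      rw [norm_smul, mul_comm]; exact mul_le_mul_of_nonneg_right (hgK x) (norm_nonneg _))
  refine ⟨m1, m2.add m3, fun φ hφ hφc hφs e => ?_⟩
  obtain ⟨ψ, hψ, hψu, hψG, -⟩ := h.exists_approx
  have hz : ∀ x, x ∉ Ω → φ x = 0 := fun x hx =>
    image_eq_zero_of_notMem_tsupport fun hx' => hx (hφs hx')
  have hz' : ∀ x, x ∉ Ω → fderiv ℝ φ x e = 0 := fun x hx => by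
    have : fderiv ℝ φ x = 0 := by
      by_contra h0
      exact hx (hφs (support_fderiv_subset ℝ h0))
    simp [this]
  -- Since `φ` is supported in `Ω`, the integrals may be taken over the plane. Each term pairs `ψ k`
  -- or its gradient with a fixed L² function, so the identity survives the limit in `k`.
  have key : ∀ k, ∫ x in Ω, ψ k x * (ζ x * fderiv ℝ φ x e) =
      -((∫ x in Ω, inner ℝ (gradient (ψ k) x) ((ζ x * φ x) • e)) +
        ∫ x in Ω, ψ k x * (inner ℝ (gradient ζ x) e * φ x)) := by
    intro k
    have hI := integral_lipschitz_mul_fderiv hζ hφ hφc (hψ k).1 e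
    rw [setIntegral_eq_integral_of_forall_compl_eq_zero
        (fun x hx => by rw [hz' x hx]; simp),
      setIntegral_eq_integral_of_forall_compl_eq_zero
        (fun x hx => by rw [hz x hx]; simp),
      setIntegral_eq_integral_of_forall_compl_eq_zero
        (fun x hx => by rw [hz x hx]; simp), hI, integral_add]
    · simp_rw [inner_smul_right, mul_comm]
    · have c2 : Continuous (fun x => inner ℝ (gradient (ψ k) x) e) :=
        (continuous_gradient (hψ k).1).inner continuous_const
      exact (c2.mul (hζ.continuous.mul hφ.continuous)).integrable_of_hasCompactSupport
        ((hφc.mul_left).mul_left)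
    · have : Integrable (fun x => ψ k x * φ x) :=
        ((hψ k).1.continuous.mul hφ.continuous).integrable_of_hasCompactSupport hφc.mul_left
      refine (this.norm.const_mul (K * ‖e‖)).mono' ?_ ?_
      · exact ((hψ k).1.continuous.aestronglyMeasurable.mul
          (((measurable_gradient ζ).inner measurable_const).aestronglyMeasurable.mul
            hφ.continuous.aestronglyMeasurable))
      · refine Eventually.of_forall fun x => ?_
        have h4 : ‖inner ℝ (gradient ζ x) e‖ ≤ K * ‖e‖ :=
          (norm_inner_le_norm _ _).trans (by gcongr; exact hgK x)
        rw [norm_mul, norm_mul, norm_mul]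
        calc ‖ψ k x‖ * (‖inner ℝ (gradient ζ x) e‖ * ‖φ x‖)
            ≤ ‖ψ k x‖ * ((K * ‖e‖) * ‖φ x‖) := by gcongr
          _ = _ := by ring
  have hφL : MemLp φ 2 (volume.restrict Ω) :=
    (hφ.continuous.memLp_of_hasCompactSupport hφc).restrict Ω
  have hdφL : MemLp (fun x => fderiv ℝ φ x e) 2 (volume.restrict Ω) :=
    (((hφ.continuous_fderiv (by simp)).clm_apply continuous_const).memLp_of_hasCompactSupport
      (hφc.fderiv_apply (𝕜 := ℝ) e)).restrict Ω
  have t1 : MemLp (fun x => ζ x * fderiv ℝ φ x e) 2 (volume.restrict Ω) :=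
    hdφL.of_le_mul (c := C) (hζm.mul hdφL.1) (Eventually.of_forall fun x => by
      rw [norm_mul]; exact mul_le_mul_of_nonneg_right (hC x) (norm_nonneg _))
  have t2 : MemLp (fun x => (ζ x * φ x) • e) 2 (volume.restrict Ω) :=
    hφL.of_le_mul (c := C * ‖e‖) ((hζm.mul hφL.1).smul aestronglyMeasurable_const)
      (Eventually.of_forall fun x => by
        rw [norm_smul, norm_mul]
        have : ‖ζ x‖ ≤ C := hC x
        calc ‖ζ x‖ * ‖φ x‖ * ‖e‖ ≤ C * ‖φ x‖ * ‖e‖ := by gcongr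
          _ = _ := by ring)
  have t3 : MemLp (fun x => inner ℝ (gradient ζ x) e * φ x) 2 (volume.restrict Ω) :=
    hφL.of_le_mul (c := K * ‖e‖) ((hgm.inner aestronglyMeasurable_const).mul hφL.1)
      (Eventually.of_forall fun x => by
        rw [norm_mul]
        have h4 : ‖inner ℝ (gradient ζ x) e‖ ≤ K * ‖e‖ :=
          (norm_inner_le_norm _ _).trans (by gcongr; exact hgK x)
        gcongr)
  have hψm : ∀ k, AEStronglyMeasurable (ψ k) (volume.restrict Ω) := fun k =>
    (hψ k).1.continuous.aestronglyMeasurable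
  have hψm' : ∀ k, AEStronglyMeasurable (gradient (ψ k)) (volume.restrict Ω) := fun k =>
    (measurable_gradient _).aestronglyMeasurable
  have cst : ∀ {F : Type} [NormedAddCommGroup F] (f : Plane → F),
      Tendsto (fun _ : ℕ => eLpNorm (fun x => f x - f x) 2 (volume.restrict Ω)) atTop (𝓝 0) := by
    intro F _ f
    simp
  have l1 := tendsto_integral_mul_of_tendsto_eLpNorm hψm hu hψu (fun _ => t1.1) t1 (cst _)
  have l2 := tendsto_integral_inner_of_tendsto_eLpNorm hψm' hG hψG (fun _ => t2.1) t2 (cst _)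
  have l3 := tendsto_integral_mul_of_tendsto_eLpNorm hψm hu hψu (fun _ => t3.1) t3 (cst _)
  simp_rw [key] at l1
  have := tendsto_nhds_unique l1 (l2.add l3).neg
  have i2 : Integrable (fun x => inner ℝ (G x) ((ζ x * φ x) • e)) (volume.restrict Ω) :=
    integrable_inner_of_memLp hG t2
  have i3 : Integrable (fun x => u x * (inner ℝ (gradient ζ x) e * φ x)) (volume.restrict Ω) :=
    hu.integrable_mul t3
  rw [← integral_add i2 i3] at this
  convert this using 1
  · exact integral_congr_ae (Eventually.of_forall fun x => by simp; ring)
  · congr 1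
    refine integral_congr_ae (Eventually.of_forall fun x => ?_)
    simp only [inner_add_left, inner_smul_left, inner_smul_right]
    simp
    ring

/-- Smoothness of `ζ` keeps `ζ ψ_k` an admissible approximating sequence, so the product has a trace
and may serve as a test function in the form. -/
theorem HasTrace.mul_smooth {Ω : Set Plane} {u : Plane → ℝ} {G : Plane → Plane}
    {g : Plane → ℝ} (h : HasTrace Ω u G g) {ζ : Plane → ℝ} (hs : ContDiff ℝ ∞ ζ) {K : NNReal}
    (hζ : LipschitzWith K ζ) {C : ℝ} (hC : ∀ x, |ζ x| ≤ C) :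
    HasTrace Ω (fun x => ζ x * u x) (fun x => ζ x • G x + u x • gradient ζ x)
      (fun x => ζ x * g x) := by
  have hgK : ∀ x, ‖gradient ζ x‖ ≤ K := fun x => by
    rw [norm_gradient_eq]; exact norm_fderiv_le_of_lipschitz ℝ hζ
  refine ⟨h.weakGradient_mul hζ hC, ?_, ?_⟩
  · exact h.memLp_trace.of_le_mul (c := C) (hs.continuous.aestronglyMeasurable.mul h.memLp_trace.1)
      (Eventually.of_forall fun x => by
        rw [norm_mul]; exact mul_le_mul_of_nonneg_right (hC x) (norm_nonneg _))
  obtain ⟨ψ, hψ, hψu, hψG, hψg⟩ := h.exists_approx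
  refine ⟨fun k x => ζ x * ψ k x, fun k => ⟨hs.mul (hψ k).1, (hψ k).2.mul_left⟩, ?_, ?_, ?_⟩
  · refine tendsto_eLpNorm_of_norm_le_mul (C := C) (fun k x => ?_) hψu
    rw [← mul_sub, norm_mul]
    exact mul_le_mul_of_nonneg_right (hC x) (norm_nonneg _)
  · have e1 : Tendsto (fun k => eLpNorm (fun x => ζ x • (gradient (ψ k) x - G x)) 2
        (volume.restrict Ω)) atTop (𝓝 0) := by
      refine tendsto_eLpNorm_of_norm_le_mul (C := C) (fun k x => ?_) hψG
      rw [norm_smul]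
      exact mul_le_mul_of_nonneg_right (hC x) (norm_nonneg _)
    have e2 : Tendsto (fun k => eLpNorm (fun x => (ψ k x - u x) • gradient ζ x) 2
        (volume.restrict Ω)) atTop (𝓝 0) := by
      refine tendsto_eLpNorm_of_norm_le_mul (C := K) (fun k x => ?_) hψu
      rw [norm_smul, mul_comm]
      exact mul_le_mul_of_nonneg_right (hgK x) (norm_nonneg _)
    have e3 := e1.add e2
    rw [add_zero] at e3
    refine tendsto_of_tendsto_of_tendsto_of_le_of_le tendsto_const_nhds e3 (fun _ => zero_le)
      (fun k => ?_)
    have hz := (measurable_gradient ζ).aestronglyMeasurable (μ := volume.restrict Ω)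
    have hzc := hs.continuous.aestronglyMeasurable (μ := volume.restrict Ω)
    have hpk := (measurable_gradient (ψ k)).aestronglyMeasurable (μ := volume.restrict Ω)
    have hpc := (hψ k).1.continuous.aestronglyMeasurable (μ := volume.restrict Ω)
    have := eLpNorm_add_le (p := 2) (hzc.smul (hpk.sub h.weakGradient.memLp_grad.1))
      ((hpc.sub h.weakGradient.memLp_fun.1).smul hz) (by norm_num)
    refine le_of_eq_of_le ?_ this
    congr 1
    funext x
    simp only [Pi.add_apply, Pi.smul_apply', Pi.sub_apply]
    rw [gradient_mul (hs.differentiable (by simp) x) ((hψ k).1.differentiable (by simp) x),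
      smul_sub, sub_smul]
    abel
  · refine tendsto_eLpNorm_of_norm_le_mul (C := C) (fun k x => ?_) hψg
    rw [← mul_sub, norm_mul]
    exact mul_le_mul_of_nonneg_right (hC x) (norm_nonneg _)

/-- A quadratic inequality for smooth compactly supported functions extends to all functions with
a trace. -/
theorem HasTrace.quadratic_le {Ω : Set Plane} {u : Plane → ℝ} {G : Plane → Plane}
    {g : Plane → ℝ} (h : HasTrace Ω u G g) {β s C : ℝ} {q : Plane → ℝ} (hq : Measurable q)
    (hqC : ∀ x, |q x| ≤ C)
    (H : ∀ φ : Plane → ℝ, ContDiff ℝ ∞ φ → HasCompactSupport φ →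
      β * ∫ x, φ x ^ 2 ∂(boundaryMeasure Ω) ≤
        s * (∫ x in Ω, ‖gradient φ x‖ ^ 2) + ∫ x in Ω, q x * φ x ^ 2) :
    β * ∫ x, g x ^ 2 ∂(boundaryMeasure Ω) ≤
      s * (∫ x in Ω, ‖G x‖ ^ 2) + ∫ x in Ω, q x * u x ^ 2 := by
  obtain ⟨ψ, hψ, hψu, hψG, hψg⟩ := h.exists_approx
  have hu := h.weakGradient.memLp_fun
  have hG := h.weakGradient.memLp_grad
  have hψm : ∀ {ν : Measure Plane} (k), AEStronglyMeasurable (ψ k) ν := fun k =>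
    (hψ k).1.continuous.aestronglyMeasurable
  have hψm' : ∀ k, AEStronglyMeasurable (gradient (ψ k)) (volume.restrict Ω) := fun k =>
    (measurable_gradient _).aestronglyMeasurable
  have l1 := tendsto_integral_mul_of_tendsto_eLpNorm hψm h.memLp_trace hψg hψm h.memLp_trace hψg
  have l2 := tendsto_integral_inner_of_tendsto_eLpNorm hψm' hG hψG hψm' hG hψG
  have hqu : MemLp (fun x => q x * u x) 2 (volume.restrict Ω) :=
    hu.of_le_mul (c := C) (hq.aestronglyMeasurable.mul hu.1) (Eventually.of_forall fun x => by
      rw [norm_mul]; exact mul_le_mul_of_nonneg_right (hqC x) (norm_nonneg _))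
  have l3 := tendsto_integral_mul_of_tendsto_eLpNorm (f := fun k x => q x * ψ k x)
    (fun k => hq.aestronglyMeasurable.mul (hψm k)) hqu
    (tendsto_eLpNorm_of_norm_le_mul (C := C) (fun k x => by
      rw [← mul_sub, norm_mul]
      exact mul_le_mul_of_nonneg_right (hqC x) (norm_nonneg _)) hψu) hψm hu hψu
  have := le_of_tendsto_of_tendsto' (l1.const_mul β) ((l2.const_mul s).add l3) (fun k => by
    have := H (ψ k) (hψ k).1 (hψ k).2
    simpa only [sq, mul_assoc, real_inner_self_eq_norm_mul_norm] using this)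
  simpa only [sq, mul_assoc, real_inner_self_eq_norm_mul_norm] using this

/-! ### Orthonormal coordinates adapted to a side -/

section Coordinates

theorem exists_orthonormal_frame {n : Plane} (hn : ‖n‖ = 1) :
    ∃ τ : Plane, ‖τ‖ = 1 ∧ inner ℝ τ n = 0 ∧
      (∀ x, x = inner ℝ τ x • τ + inner ℝ n x • n) ∧
      MeasurePreserving (fun z : ℝ × ℝ => z.1 • τ + z.2 • n) volume volume := by
  obtain ⟨b, hb⟩ := Orthonormal.exists_orthonormalBasis_extension_of_card_eq
    (𝕜 := ℝ) (E := Plane) (ι := Fin 2) (by simp) (v := fun _ => n) (s := {1}) (by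
      constructor
      · intro i; simpa using hn
      · intro i j hij
        exact absurd (Subsingleton.elim i j) hij)
  have hb1 : b 1 = n := hb 1 rfl
  refine ⟨b 0, b.orthonormal.1 0, ?_, fun x => ?_, ?_⟩
  · rw [← hb1]; exact b.orthonormal.2 (by decide)
  · have := b.sum_repr' x
    rw [Fin.sum_univ_two, hb1] at this
    exact this.symm
  · have h1 := b.measurePreserving_repr_symm
    have h2 := (PiLp.volume_preserving_toLp (Fin 2))
    have h3 := (volume_preserving_finTwoArrow ℝ).symm
    convert (h1.comp (h2.comp h3)) using 1
    funext z
    have := b.sum_repr_symm !₂[z.1, z.2]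
    rw [Fin.sum_univ_two] at this
    simpa [← hb1] using this

/-- For unit `n` orthogonal to `τ`, reversing the normal coordinate makes `z.2` the distance below
the line ⟪n, x⟫ = c, which is the variable to be rescaled in the boundary layer. -/
theorem measurePreserving_frame {τ n : Plane}
    (h : MeasurePreserving (fun z : ℝ × ℝ => z.1 • τ + z.2 • n) volume volume) (c : ℝ) :
    MeasurePreserving (fun z : ℝ × ℝ => z.1 • τ + (c - z.2) • n) volume volume := by
  have h1 : MeasurePreserving (fun r : ℝ => c - r) volume volume :=
    Measure.measurePreserving_sub_left volume c
  have h2 : MeasurePreserving (Prod.map id (fun r : ℝ => c - r)) (volume : Measure (ℝ × ℝ))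
      (volume : Measure (ℝ × ℝ)) := (MeasurePreserving.id volume).prod h1
  exact h.comp h2

end Coordinates

/-! ### The cutoff profile -/

theorem continuous_deriv_smoothTransition : Continuous (deriv Real.smoothTransition) :=
  (Real.smoothTransition.contDiff (n := 1)).continuous_deriv le_rfl

theorem deriv_smoothTransition_eq_zero {x : ℝ} (hx : x ∉ Icc (0 : ℝ) 1) :
    deriv Real.smoothTransition x = 0 := by
  rcases lt_or_ge x 0 with h | h
  · have : Real.smoothTransition =ᶠ[𝓝 x] fun _ => 0 := by
      filter_upwards [Iio_mem_nhds h] with y hy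
      exact Real.smoothTransition.zero_of_nonpos (le_of_lt hy)
    rw [this.deriv_eq]; simp
  · have h1 : 1 < x := by
      by_contra h'; exact hx ⟨h, not_lt.1 h'⟩
    have : Real.smoothTransition =ᶠ[𝓝 x] fun _ => 1 := by
      filter_upwards [Ioi_mem_nhds h1] with y hy
      exact Real.smoothTransition.one_of_one_le (le_of_lt hy)
    rw [this.deriv_eq]; simp

theorem hasCompactSupport_deriv_smoothTransition :
    HasCompactSupport (deriv Real.smoothTransition) :=
  HasCompactSupport.intro isCompact_Icc fun _ hx => deriv_smoothTransition_eq_zero hx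

theorem integrable_deriv_smoothTransition : Integrable (deriv Real.smoothTransition) :=
  continuous_deriv_smoothTransition.integrable_of_hasCompactSupport
    hasCompactSupport_deriv_smoothTransition

theorem integral_deriv_smoothTransition : ∫ r, deriv Real.smoothTransition r = 1 := by
  have := integral_of_hasDerivAt_of_tendsto (f := Real.smoothTransition) (m := 0) (n := 1)
    (fun x => ((Real.smoothTransition.contDiff (n := 1)).differentiable (by simp) x).hasDerivAt)
    integrable_deriv_smoothTransition
    (tendsto_const_nhds.congr' (by
      filter_upwards [eventually_le_atBot 0] with x hx
      exact (Real.smoothTransition.zero_of_nonpos hx).symm))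
    (tendsto_const_nhds.congr' (by
      filter_upwards [eventually_ge_atTop 1] with x hx
      exact (Real.smoothTransition.one_of_one_le hx).symm))
  simpa using this

theorem tendsto_smoothTransition_div {ε d : ℕ → ℝ} {d₀ : ℝ} (hε : ∀ m, 0 < ε m)
    (hε0 : Tendsto ε atTop (𝓝 0)) (hd : Tendsto d atTop (𝓝 d₀)) (h0 : d₀ ≠ 0) :
    Tendsto (fun m => Real.smoothTransition (d m / ε m)) atTop
      (𝓝 (if 0 < d₀ then 1 else 0)) := by
  refine tendsto_const_nhds.congr' ?_
  split_ifs with h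
  · filter_upwards [hε0.eventually_lt_const (half_pos h),
      hd.eventually_const_lt (half_lt_self h)] with m h1 h2
    exact (Real.smoothTransition.one_of_one_le ((one_le_div (hε m)).2 (h1.trans h2).le)).symm
  · have h' : d₀ < 0 := lt_of_le_of_ne (not_lt.1 h) h0
    filter_upwards [hd.eventually_lt_const h'] with m h1
    exact (Real.smoothTransition.zero_of_nonpos (div_nonpos_of_nonpos_of_nonneg h1.le
      (hε m).le)).symm

/-! ### Polygons, smoothed indicators and boundary layers -/

section Polygon

variable {ι : Type*}

/-- The signed distance from `x` to the line with unit normal `n i`, positive inside. -/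
noncomputable def slack (n : ι → Plane) (c : ι → ℝ) (i : ι) (x : Plane) : ℝ := c i - inner ℝ (n i) x

theorem continuous_slack (n : ι → Plane) (c : ι → ℝ) (i : ι) : Continuous (slack n c i) :=
  continuous_const.sub (continuous_const.inner continuous_id)

theorem contDiff_slack (n : ι → Plane) (c : ι → ℝ) (i : ι) : ContDiff ℝ ∞ (slack n c i) :=
  contDiff_const.sub (contDiff_const.inner ℝ contDiff_id)

/-- The polygon cut out by the half-planes `⟪n i, x⟫ < c i`. -/
def polygon (n : ι → Plane) (c : ι → ℝ) : Set Plane := {x | ∀ i, 0 < slack n c i x}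

/-- The closed polygon. -/
def closedPolygon (n : ι → Plane) (c : ι → ℝ) : Set Plane := {x | ∀ i, 0 ≤ slack n c i x}

theorem isClosed_closedPolygon (n : ι → Plane) (c : ι → ℝ) : IsClosed (closedPolygon n c) := by
  simp only [closedPolygon, ofPred_forall]
  exact isClosed_iInter fun i => isClosed_le continuous_const (continuous_slack n c i)

theorem polygon_subset_closedPolygon (n : ι → Plane) (c : ι → ℝ) :
    polygon n c ⊆ closedPolygon n c := fun _ hx i => (hx i).le

/-- The closed side of the polygon on the line with normal `n i`. -/
def side (n : ι → Plane) (c : ι → ℝ) (i : ι) : Set Plane :=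
  {x | x ∈ closedPolygon n c ∧ slack n c i x = 0}

theorem isClosed_side (n : ι → Plane) (c : ι → ℝ) (i : ι) : IsClosed (side n c i) :=
  (isClosed_closedPolygon n c).inter (isClosed_eq (continuous_slack n c i) continuous_const)

variable [Fintype ι]

theorem isOpen_polygon (n : ι → Plane) (c : ι → ℝ) : IsOpen (polygon n c) := by
  simp only [polygon, ofPred_forall]
  exact isOpen_iInter_of_finite fun i => isOpen_lt continuous_const (continuous_slack n c i)

theorem frontier_polygon_subset (n : ι → Plane) (c : ι → ℝ) :
    frontier (polygon n c) ⊆ ⋃ i, side n c i := by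
  intro x hx
  rw [(isOpen_polygon n c).frontier_eq] at hx
  have h1 : x ∈ closedPolygon n c :=
    closure_minimal (polygon_subset_closedPolygon n c) (isClosed_closedPolygon n c) hx.1
  have h2 : ∃ i, ¬ 0 < slack n c i x := by
    by_contra h
    push Not at h
    exact hx.2 h
  obtain ⟨i, hi⟩ := h2
  exact mem_iUnion.2 ⟨i, h1, le_antisymm (not_lt.1 hi) (h1 i)⟩

/-- The product is a smoothed indicator: it lies in `[0, 1]`, vanishes exactly outside the open
polygon, and tends to 1 inside. Dominated convergence applies. -/
theorem tendsto_integral_mul_prod_smoothTransition (n : ι → Plane) (c : ι → ℝ) {ε : ℕ → ℝ}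
    (hε : ∀ m, 0 < ε m) (hε0 : Tendsto ε atTop (𝓝 0)) {f : Plane → ℝ} (hf : Continuous f)
    (hfc : HasCompactSupport f) :
    Tendsto (fun m => ∫ x, f x * ∏ i, Real.smoothTransition (slack n c i x / ε m)) atTop
      (𝓝 (∫ x in polygon n c, f x)) := by
  rw [← integral_indicator (isOpen_polygon n c).measurableSet]
  refine tendsto_integral_of_dominated_convergence (fun x => ‖f x‖) ?_
    (hf.integrable_of_hasCompactSupport hfc).norm ?_ ?_
  · intro m
    refine (hf.mul (continuous_finsetProd _ fun i _ => ?_)).aestronglyMeasurable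
    exact Real.smoothTransition.continuous.comp ((continuous_slack n c i).div_const _)
  · intro m
    refine Eventually.of_forall fun x => ?_
    rw [norm_mul]
    refine mul_le_of_le_one_right (norm_nonneg _) ?_
    rw [Real.norm_of_nonneg (Finset.prod_nonneg fun i _ => Real.smoothTransition.nonneg _)]
    exact Finset.prod_le_one (fun i _ => Real.smoothTransition.nonneg _)
      (fun i _ => Real.smoothTransition.le_one _)
  · refine Eventually.of_forall fun x => ?_
    by_cases hx : x ∈ polygon n c
    · rw [indicator_of_mem hx]
      have : Tendsto (fun m => f x * ∏ i, Real.smoothTransition (slack n c i x / ε m)) atTop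
          (𝓝 (f x * ∏ i : ι, (if 0 < slack n c i x then 1 else 0))) :=
        (tendsto_finsetProd _ fun i _ =>
          tendsto_smoothTransition_div hε hε0 tendsto_const_nhds (hx i).ne').const_mul _
      have h1 : ∏ i : ι, (if 0 < slack n c i x then (1 : ℝ) else 0) = 1 :=
        Finset.prod_eq_one fun i _ => if_pos (hx i)
      rwa [h1, mul_one] at this
    · rw [indicator_of_notMem hx]
      have : ∃ i, ¬ 0 < slack n c i x := by
        by_contra h
        push Not at h
        exact hx h
      obtain ⟨i, hi⟩ := this
      refine tendsto_const_nhds.congr fun m => ?_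
      rw [Finset.prod_eq_zero (Finset.mem_univ i), mul_zero]
      exact Real.smoothTransition.zero_of_nonpos
        (div_nonpos_of_nonpos_of_nonneg (not_lt.1 hi) (hε m).le)

variable [DecidableEq ι]

/-- The derivative of the smoothed indicator concentrates in a strip of width `ε m` along line `i`.
Rescaling the normal coordinate turns the strip into a fixed one; the profile has integral 1, and
the remaining cutoffs tend to the indicator of the side. -/
theorem tendsto_integral_layer (n : ι → Plane) (c : ι → ℝ) {ε : ℕ → ℝ}
    (hε : ∀ m, 0 < ε m) (hε0 : Tendsto ε atTop (𝓝 0)) {f : Plane → ℝ} (hf : Continuous f)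
    (hfc : HasCompactSupport f) (i : ι) {τ : Plane} (hi : ‖n i‖ = 1) (hτ : ‖τ‖ = 1)
    (hτi : inner ℝ τ (n i) = 0)
    (hm : MeasurePreserving (fun z : ℝ × ℝ => z.1 • τ + z.2 • n i) volume volume)
    (hne : ∀ᵐ y : ℝ, ∀ k ≠ i, slack n c k (y • τ + c i • n i) ≠ 0) :
    Tendsto (fun m => ∫ x, f x * ((ε m)⁻¹ * deriv Real.smoothTransition (slack n c i x / ε m) *
        ∏ k ∈ Finset.univ.erase i, Real.smoothTransition (slack n c k x / ε m))) atTop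
      (𝓝 (∫ y : ℝ, f (y • τ + c i • n i) * ∏ k ∈ Finset.univ.erase i,
        (if 0 < slack n c k (y • τ + c i • n i) then 1 else 0))) := by
  set γ : ℝ × ℝ → Plane := fun z => z.1 • τ + (c i - z.2) • n i with hγ
  have hγc : Continuous γ := by fun_prop
  have hmγ : MeasurePreserving γ volume volume := measurePreserving_frame hm (c i)
  have hsl : ∀ z, slack n c i (γ z) = z.2 := by
    intro z
    simp only [slack, hγ, inner_add_right, inner_smul_right, real_inner_self_eq_norm_sq, hi,
      real_inner_comm τ, hτi]
    ring
  have hτγ : ∀ z, inner ℝ τ (γ z) = z.1 := by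
    intro z
    simp only [hγ, inner_add_right, inner_smul_right, real_inner_self_eq_norm_sq, hτ, hτi]
    ring
  obtain ⟨R, hR⟩ := hfc.isCompact.isBounded.subset_closedBall 0
  obtain ⟨M, hM⟩ := hfc.exists_bound_of_continuous hf
  have hM0 : 0 ≤ M := (norm_nonneg _).trans (hM 0)
  set h' := deriv Real.smoothTransition with hh'
  have hh'c : Continuous h' := continuous_deriv_smoothTransition
  -- This is the integrand after substituting `r = ε m * z.2`, whose Jacobian cancels `(ε m)⁻¹`.
  set Ψ : ℕ → ℝ × ℝ → ℝ := fun m z => f (γ (z.1, ε m * z.2)) * (h' z.2 *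
    ∏ k ∈ Finset.univ.erase i, Real.smoothTransition (slack n c k (γ (z.1, ε m * z.2)) / ε m))
    with hΨ
  -- An integrable majorant independent of `m`: the tangential coordinate is at most the norm, so
  -- `f` vanishes once it leaves `[-R, R]`.
  set bd : ℝ × ℝ → ℝ := fun z => (Icc (-R) R).indicator (fun _ => M) z.1 * ‖h' z.2‖ with hbd
  have hbdi : Integrable bd (volume : Measure (ℝ × ℝ)) :=
    Integrable.mul_prod (f := (Icc (-R) R).indicator (fun _ => M))
      ((integrable_indicator_iff measurableSet_Icc).2 (integrableOn_const (by simp)))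
      integrable_deriv_smoothTransition.norm
  have hΨc : ∀ m, Continuous (Ψ m) := by
    intro m
    have h1 : Continuous fun z : ℝ × ℝ => γ (z.1, ε m * z.2) := hγc.comp (by fun_prop)
    refine (hf.comp h1).mul ((hh'c.comp continuous_snd).mul
      (continuous_finsetProd _ fun k _ => ?_))
    exact Real.smoothTransition.continuous.comp
      (((continuous_slack n c k).comp h1).div_const _)
  have hΨb : ∀ m z, ‖Ψ m z‖ ≤ bd z := by
    intro m z
    have hp : ‖∏ k ∈ Finset.univ.erase i,
        Real.smoothTransition (slack n c k (γ (z.1, ε m * z.2)) / ε m)‖ ≤ 1 := by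
      rw [Real.norm_of_nonneg (Finset.prod_nonneg fun i _ => Real.smoothTransition.nonneg _)]
      exact Finset.prod_le_one (fun i _ => Real.smoothTransition.nonneg _)
        (fun i _ => Real.smoothTransition.le_one _)
    have hf1 : ‖f (γ (z.1, ε m * z.2))‖ ≤ (Icc (-R) R).indicator (fun _ => M) z.1 := by
      by_cases hz : z.1 ∈ Icc (-R) R
      · rw [indicator_of_mem hz]; exact hM _
      · rw [indicator_of_notMem hz]
        refine le_of_eq ?_
        rw [norm_eq_zero]
        by_contra h0
        have h1 := hR (subset_tsupport f h0)
        rw [mem_closedBall_zero_iff] at h1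
        have h2 := abs_real_inner_le_norm τ (γ (z.1, ε m * z.2))
        rw [hτγ, hτ, one_mul] at h2
        exact hz (abs_le.1 (h2.trans h1))
    simp only [hΨ, hbd, norm_mul]
    have : (0:ℝ) ≤ (Icc (-R) R).indicator (fun _ => M) z.1 := (norm_nonneg _).trans hf1
    calc _ ≤ (Icc (-R) R).indicator (fun _ => M) z.1 * (‖h' z.2‖ * 1) := by gcongr
      _ = _ := by ring
  have hΨi : ∀ m, Integrable (Ψ m) (volume : Measure (ℝ × ℝ)) := fun m =>
    hbdi.mono' (hΨc m).aestronglyMeasurable (Eventually.of_forall (hΨb m))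
  have heq : ∀ m, ∫ x, f x * ((ε m)⁻¹ * h' (slack n c i x / ε m) *
        ∏ k ∈ Finset.univ.erase i, Real.smoothTransition (slack n c k x / ε m)) =
      ∫ z, Ψ m z := by
    intro m
    have hFc : Continuous fun x => f x * ((ε m)⁻¹ * h' (slack n c i x / ε m) *
        ∏ k ∈ Finset.univ.erase i, Real.smoothTransition (slack n c k x / ε m)) := by
      refine hf.mul ((continuous_const.mul (hh'c.comp ((continuous_slack n c i).div_const _))).mul
        (continuous_finsetProd _ fun k _ => ?_))
      exact Real.smoothTransition.continuous.comp ((continuous_slack n c k).div_const _)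
    have hFi := hFc.integrable_of_hasCompactSupport (μ := volume) hfc.mul_right
    rw [← hmγ.map_eq, integral_map hmγ.measurable.aemeasurable hFc.aestronglyMeasurable]
    have hi2 : Integrable (fun z => f (γ z) * ((ε m)⁻¹ * h' (slack n c i (γ z) / ε m) *
        ∏ k ∈ Finset.univ.erase i, Real.smoothTransition (slack n c k (γ z) / ε m))) volume :=
      hmγ.integrable_comp_of_integrable hFi
    rw [Measure.volume_eq_prod, integral_prod _ hi2, integral_prod _ (hΨi m)]
    refine integral_congr_ae (Eventually.of_forall fun y => ?_)
    have := Measure.integral_comp_mul_left (fun r => f (γ (y, r)) *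
      ((ε m)⁻¹ * h' (slack n c i (γ (y, r)) / ε m) *
        ∏ k ∈ Finset.univ.erase i, Real.smoothTransition (slack n c k (γ (y, r)) / ε m))) (ε m)
    rw [abs_of_pos (inv_pos.2 (hε m)), smul_eq_mul] at this
    have h2 := (eq_inv_mul_iff_mul_eq₀ (hε m).ne').1 this
    simp only []
    rw [← h2, ← integral_const_mul]
    refine integral_congr_ae (Eventually.of_forall fun r => ?_)
    have he := (hε m).ne'
    simp only [hsl, hΨ]
    rw [mul_div_cancel_left₀ _ he]
    field_simp
  simp_rw [heq]
  have hlim : ∫ z : ℝ × ℝ, (f (z.1 • τ + c i • n i) * ∏ k ∈ Finset.univ.erase i,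
        (if 0 < slack n c k (z.1 • τ + c i • n i) then 1 else 0)) * h' z.2 =
      ∫ y : ℝ, f (y • τ + c i • n i) * ∏ k ∈ Finset.univ.erase i,
        (if 0 < slack n c k (y • τ + c i • n i) then 1 else 0) := by
    rw [Measure.volume_eq_prod, integral_prod_mul (fun y : ℝ => f (y • τ + c i • n i) *
      ∏ k ∈ Finset.univ.erase i, (if 0 < slack n c k (y • τ + c i • n i) then (1 : ℝ) else 0)) h',
      integral_deriv_smoothTransition, mul_one]
  rw [← hlim]
  refine tendsto_integral_of_dominated_convergence bd
    (fun m => (hΨc m).aestronglyMeasurable) hbdi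
    (fun m => Eventually.of_forall (hΨb m)) ?_
  have hne' : ∀ᵐ z : ℝ × ℝ, ∀ k ≠ i, slack n c k (z.1 • τ + c i • n i) ≠ 0 :=
    Measure.quasiMeasurePreserving_fst.ae hne
  filter_upwards [hne'] with z hz
  have hγ0 : Tendsto (fun m => γ (z.1, ε m * z.2)) atTop (𝓝 (z.1 • τ + c i • n i)) := by
    have h1 : Tendsto (fun m => (z.1, ε m * z.2)) atTop (𝓝 (z.1, 0 * z.2)) :=
      tendsto_const_nhds.prodMk_nhds (hε0.mul_const _)
    have h2 := (hγc.tendsto _).comp h1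
    simpa [hγ, Function.comp_def] using h2
  have hprod := tendsto_finsetProd (Finset.univ.erase i) (fun k hk =>
    tendsto_smoothTransition_div hε hε0 (((continuous_slack n c k).tendsto _).comp hγ0)
      (hz k (Finset.ne_of_mem_erase hk)))
  have := ((hf.tendsto _).comp hγ0).mul (hprod.const_mul (h' z.2))
  rw [mul_left_comm, mul_comm (h' z.2)] at this
  exact this

end Polygon

/-! ### Divergence of smooth fields -/

/-- The divergence of a vector field on the plane. -/
noncomputable def divergence (X : Plane → Plane) (x : Plane) : ℝ :=
  ∑ k : Fin 2, fderiv ℝ (fun y => X y k) x (EuclideanSpace.single k 1)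

theorem contDiff_coord {X : Plane → Plane} (hX : ContDiff ℝ ∞ X) (k : Fin 2) :
    ContDiff ℝ ∞ fun y => X y k := (contDiff_euclidean.1 hX) k

theorem hasCompactSupport_coord {X : Plane → Plane} (hX : HasCompactSupport X) (k : Fin 2) :
    HasCompactSupport fun y => X y k :=
  hX.comp_left (g := fun v : Plane => v k) (by simp)

theorem continuous_divergence {X : Plane → Plane} (hX : ContDiff ℝ ∞ X) :
    Continuous (divergence X) :=
  continuous_finsetSum _ fun k _ =>
    ((contDiff_coord hX k).continuous_fderiv (by simp)).clm_apply continuous_const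

theorem hasCompactSupport_divergence {X : Plane → Plane} (hX : HasCompactSupport X) :
    HasCompactSupport (divergence X) := by
  have h0 := (hasCompactSupport_coord hX 0).fderiv_apply (𝕜 := ℝ) (EuclideanSpace.single 0 1)
  have h1 := (hasCompactSupport_coord hX 1).fderiv_apply (𝕜 := ℝ) (EuclideanSpace.single 1 1)
  have : divergence X = (fun x => fderiv ℝ (fun y => X y 0) x (EuclideanSpace.single 0 1)) +
      fun x => fderiv ℝ (fun y => X y 1) x (EuclideanSpace.single 1 1) := by
    funext x
    simp [divergence, Fin.sum_univ_two]
  rw [this]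
  exact h0.add h1

theorem map_eq_sum_coord (A : Plane →L[ℝ] ℝ) (v : Plane) :
    A v = ∑ k : Fin 2, v k * A (EuclideanSpace.single k 1) := by
  have : v = ∑ k : Fin 2, v k • EuclideanSpace.single k (1 : ℝ) := by
    ext j
    fin_cases j <;> simp
  conv_lhs => rw [this]
  simp only [map_sum, map_smul, smul_eq_mul]

theorem integral_divergence_mul {X : Plane → Plane} (hX : ContDiff ℝ ∞ X)
    (hXc : HasCompactSupport X) {g : Plane → ℝ} (hg : ContDiff ℝ ∞ g) :
    ∫ x, divergence X x * g x = -∫ x, fderiv ℝ g x (X x) := by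
  have hgd := hg.continuous_fderiv (by simp)
  have i1 : ∀ k : Fin 2, Integrable
      (fun x => fderiv ℝ (fun y => X y k) x (EuclideanSpace.single k 1) * g x) := fun k =>
    ((((contDiff_coord hX k).continuous_fderiv (by simp)).clm_apply continuous_const).mul
      hg.continuous).integrable_of_hasCompactSupport
      ((hasCompactSupport_coord hXc k).fderiv_apply (𝕜 := ℝ) _).mul_right
  have i2 : ∀ k : Fin 2, Integrable
      (fun x => X x k * fderiv ℝ g x (EuclideanSpace.single k 1)) := fun k =>
    ((contDiff_coord hX k).continuous.mul
      (hgd.clm_apply continuous_const)).integrable_of_hasCompactSupport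
      (hasCompactSupport_coord hXc k).mul_right
  have i3 : ∀ k : Fin 2, Integrable (fun x => X x k * g x) := fun k =>
    ((contDiff_coord hX k).continuous.mul hg.continuous).integrable_of_hasCompactSupport
      (hasCompactSupport_coord hXc k).mul_right
  have e1 : ∀ x, divergence X x * g x =
      ∑ k : Fin 2, fderiv ℝ (fun y => X y k) x (EuclideanSpace.single k 1) * g x := fun x => by
    rw [divergence, Finset.sum_mul]
  have e2 : ∀ x, fderiv ℝ g x (X x) =
      ∑ k : Fin 2, X x k * fderiv ℝ g x (EuclideanSpace.single k 1) := fun x =>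
    map_eq_sum_coord _ _
  rw [integral_congr_ae (Eventually.of_forall e1), integral_congr_ae (Eventually.of_forall e2),
    integral_finsetSum _ fun k _ => i1 k, integral_finsetSum _ fun k _ => i2 k,
    ← Finset.sum_neg_distrib]
  refine Finset.sum_congr rfl fun k _ => ?_
  rw [integral_mul_fderiv_eq_neg_fderiv_mul_of_integrable (i1 k) (i2 k) (i3 k)
    (fun x _ => (contDiff_coord hX k).differentiable (by simp) x)
    (fun x _ => hg.differentiable (by simp) x), neg_neg]

theorem divergence_smul {f : Plane → ℝ} {V : Plane → Plane} (hf : ContDiff ℝ ∞ f)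
    (hV : ContDiff ℝ ∞ V) (x : Plane) :
    divergence (fun y => f y • V y) x = fderiv ℝ f x (V x) + f x * divergence V x := by
  rw [map_eq_sum_coord (fderiv ℝ f x), divergence, divergence, Finset.mul_sum,
    ← Finset.sum_add_distrib]
  refine Finset.sum_congr rfl fun k _ => ?_
  have : (fun y => (f y • V y) k) = fun y => f y * V y k := by funext y; simp
  rw [this, fderiv_fun_mul (hf.differentiable (by simp) x)
    ((contDiff_coord hV k).differentiable (by simp) x)]
  simp
  ring

/-- Turns a Lipschitz constant of the field into a bound on its divergence; after dilation by `L`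
this is what makes the divergence `O(1/L)`. -/
theorem abs_divergence_le {V : Plane → Plane} (hV : ContDiff ℝ ∞ V) (x : Plane) :
    |divergence V x| ≤ 2 * ‖fderiv ℝ V x‖ := by
  have h : ∀ k : Fin 2, |fderiv ℝ (fun y => V y k) x (EuclideanSpace.single k 1)| ≤
      ‖fderiv ℝ V x‖ := by
    intro k
    have h1 : HasFDerivAt (fun y => V y k)
        ((EuclideanSpace.proj k : Plane →L[ℝ] ℝ).comp (fderiv ℝ V x)) x :=
      (EuclideanSpace.proj k : Plane →L[ℝ] ℝ).hasFDerivAt.comp x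
        (hV.differentiable (by simp) x).hasFDerivAt
    rw [h1.fderiv]
    have h2 := PiLp.norm_apply_le (p := 2) (fderiv ℝ V x (EuclideanSpace.single k 1)) k
    have h3 := (fderiv ℝ V x).le_opNorm (EuclideanSpace.single k 1)
    rw [PiLp.norm_single, norm_one, mul_one] at h3
    exact h2.trans h3
  rw [divergence, Fin.sum_univ_two]
  linarith [abs_add_le (fderiv ℝ (fun y => V y 0) x (EuclideanSpace.single 0 1))
    (fderiv ℝ (fun y => V y 1) x (EuclideanSpace.single 1 1)), h 0, h 1]

/-! ### The divergence theorem on polygons and the resulting form inequality -/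

section Polygon

variable {ι : Type*} [Fintype ι]

/-- Non-parallel lines meet in one point. Parallel ones meet only if they coincide: with equal
normals this contradicts injectivity, and with opposite normals the polygon would be empty. -/
theorem ae_slack_ne_zero {n : ι → Plane} {c : ι → ℝ} (hn : ∀ i, ‖n i‖ = 1)
    (hinj : Function.Injective fun i => (n i, c i)) (hne : (polygon n c).Nonempty) (i : ι)
    {τ : Plane} (hx : ∀ x, x = inner ℝ τ x • τ + inner ℝ (n i) x • n i) :
    ∀ᵐ y : ℝ, ∀ k ≠ i, slack n c k (y • τ + c i • n i) ≠ 0 := by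
  rw [ae_all_iff]
  intro k
  by_cases hk : k = i
  · simp [hk]
  have hs : ∀ y : ℝ, slack n c k (y • τ + c i • n i) =
      c k - (y * inner ℝ τ (n k) + c i * inner ℝ (n i) (n k)) := by
    intro y
    simp only [slack, inner_add_right, inner_smul_right, real_inner_comm (n k)]
  by_cases ht : inner ℝ τ (n k) = 0
  · have h1 := hx (n k)
    rw [ht, zero_smul, zero_add] at h1
    set s := inner ℝ (n i) (n k) with hsd
    have h2 : |s| = 1 := by
      have := hn k
      rw [h1, norm_smul, hn i, mul_one] at this
      exact this
    refine Eventually.of_forall fun y _ h0 => ?_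
    rw [hs, ht, mul_zero, zero_add] at h0
    rcases (abs_eq zero_le_one).1 h2 with h3 | h3
    · rw [h3] at h1 h0
      refine hk (hinj ?_)
      simp only [Prod.mk.injEq]
      exact ⟨by rw [h1, one_smul], by linarith⟩
    · rw [h3] at h1 h0
      obtain ⟨p, hp⟩ := hne
      have e1 := hp i
      have e2 := hp k
      rw [slack, h1, inner_smul_left] at e2
      rw [slack] at e1
      simp at e2
      linarith
  · have : ({(c k - c i * inner ℝ (n i) (n k)) / inner ℝ τ (n k)} : Set ℝ)ᶜ ∈ ae volume :=
      compl_mem_ae_iff.2 (measure_singleton _)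
    filter_upwards [this] with y hy _ h0
    refine hy ?_
    rw [mem_singleton_iff, eq_div_iff ht]
    rw [hs] at h0
    linarith

variable [DecidableEq ι]

theorem fderiv_prod_smoothTransition (n : ι → Plane) (c : ι → ℝ) (ε : ℝ) (x v : Plane) :
    fderiv ℝ (fun x => ∏ i, Real.smoothTransition (slack n c i x / ε)) x v =
      -∑ i, inner ℝ (n i) v * (ε⁻¹ * deriv Real.smoothTransition (slack n c i x / ε) *
        ∏ k ∈ Finset.univ.erase i, Real.smoothTransition (slack n c k x / ε)) := by
  have h1 : ∀ i, HasFDerivAt (fun x => Real.smoothTransition (slack n c i x / ε))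
      (-(ε⁻¹ * deriv Real.smoothTransition (slack n c i x / ε)) • innerSL ℝ (n i)) x := by
    intro i
    have h2 : HasFDerivAt (fun x => slack n c i x / ε) (ε⁻¹ • (-innerSL ℝ (n i))) x := by
      have : HasFDerivAt (slack n c i) (-innerSL ℝ (n i)) x :=
        ((innerSL ℝ (n i)).hasFDerivAt (x := x)).const_sub (c i)
      simpa only [div_eq_inv_mul] using this.const_mul ε⁻¹
    have h3 := (((Real.smoothTransition.contDiff (n := 1)).differentiable (by simp)
      (slack n c i x / ε)).hasDerivAt).comp_hasFDerivAt x h2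
    refine h3.congr_fderiv ?_
    ext w
    simp
    ring
  rw [(HasFDerivAt.finsetProd fun i _ => h1 i).fderiv]
  simp [Finset.sum_neg_distrib]
  refine Finset.sum_congr rfl fun i _ => ?_
  ring

/-- The divergence theorem on a polygon. -/
theorem integral_divergence_polygon {n : ι → Plane} {c : ι → ℝ} (hn : ∀ i, ‖n i‖ = 1)
    (hinj : Function.Injective fun i => (n i, c i)) (hne : (polygon n c).Nonempty)
    {τ : ι → Plane} (hτ : ∀ i, ‖τ i‖ = 1) (hτn : ∀ i, inner ℝ (τ i) (n i) = 0)
    (hx : ∀ i x, x = inner ℝ (τ i) x • τ i + inner ℝ (n i) x • n i)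
    (hm : ∀ i, MeasurePreserving (fun z : ℝ × ℝ => z.1 • τ i + z.2 • n i) volume volume)
    {X : Plane → Plane} (hX : ContDiff ℝ ∞ X) (hXc : HasCompactSupport X) :
    ∫ x in polygon n c, divergence X x =
      ∑ i, ∫ y : ℝ, inner ℝ (n i) (X (y • τ i + c i • n i)) * ∏ k ∈ Finset.univ.erase i,
        (if 0 < slack n c k (y • τ i + c i • n i) then 1 else 0) := by
  set ε : ℕ → ℝ := fun m => 1 / ((m : ℝ) + 1) with hε
  have hε1 : ∀ m, 0 < ε m := fun m => Nat.one_div_pos_of_nat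
  have hε0 : Tendsto ε atTop (𝓝 0) := tendsto_one_div_add_atTop_nhds_zero_nat
  have l1 := tendsto_integral_mul_prod_smoothTransition n c hε1 hε0 (continuous_divergence hX)
    (hasCompactSupport_divergence hXc)
  have hfc : ∀ i, Continuous fun x => inner ℝ (n i) (X x) := fun i =>
    continuous_const.inner hX.continuous
  have hfs : ∀ i, HasCompactSupport fun x => inner ℝ (n i) (X x) := fun i =>
    hXc.comp_left (g := fun v => inner ℝ (n i) v) (by simp)
  have l2 := tendsto_finsetSum Finset.univ fun i _ =>
    tendsto_integral_layer n c hε1 hε0 (hfc i) (hfs i) i (hn i) (hτ i) (hτn i) (hm i)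
      (ae_slack_ne_zero hn hinj hne i (hx i))
  refine tendsto_nhds_unique l1 (l2.congr fun m => ?_)
  have hg : ContDiff ℝ ∞ fun x => ∏ i, Real.smoothTransition (slack n c i x / ε m) :=
    contDiff_prod fun i _ => Real.smoothTransition.contDiff.comp
      ((contDiff_slack n c i).div_const _)
  -- Integrating by parts against the smoothed indicator leaves minus its derivative along `X`,
  -- which is exactly the sum of the layer integrands.
  rw [integral_divergence_mul hX hXc hg, ← integral_finsetSum, ← integral_neg]
  · refine integral_congr_ae (Eventually.of_forall fun x => ?_)
    simp only []
    rw [fderiv_prod_smoothTransition, neg_neg]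
  · intro i _
    refine Continuous.integrable_of_hasCompactSupport ?_ (hfs i).mul_right
    refine (hfc i).mul ((continuous_const.mul (continuous_deriv_smoothTransition.comp
      ((continuous_slack n c i).div_const _))).mul (continuous_finsetProd _ fun k _ => ?_))
    exact Real.smoothTransition.continuous.comp ((continuous_slack n c k).div_const _)

/-- An upper bound for boundary integrals in terms of the parametrized sides. -/
theorem integral_boundaryMeasure_polygon_le {n : ι → Plane} {c : ι → ℝ} (hn : ∀ i, ‖n i‖ = 1)
    (hinj : Function.Injective fun i => (n i, c i)) (hne : (polygon n c).Nonempty)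
    {τ : ι → Plane} (hτ : ∀ i, ‖τ i‖ = 1) (hτn : ∀ i, inner ℝ (τ i) (n i) = 0)
    (hx : ∀ i x, x = inner ℝ (τ i) x • τ i + inner ℝ (n i) x • n i)
    {f : Plane → ℝ} (hf : Continuous f) (hfc : HasCompactSupport f) (hf0 : ∀ x, 0 ≤ f x) :
    ∫ x, f x ∂(boundaryMeasure (polygon n c)) ≤
      ∑ i, ∫ y : ℝ, f (y • τ i + c i • n i) * ∏ k ∈ Finset.univ.erase i,
        (if 0 < slack n c k (y • τ i + c i • n i) then 1 else 0) := by
  have hiso : ∀ i, Isometry fun y : ℝ => y • τ i + c i • n i := by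
    intro i
    refine Isometry.of_dist_eq fun y z => ?_
    rw [dist_add_right, dist_eq_norm, ← sub_smul, norm_smul, hτ i, mul_one, Real.dist_eq,
      Real.norm_eq_abs]
  set ν : ι → Measure Plane := fun i => (Measure.hausdorffMeasure 1).restrict (side n c i)
  have hsub : ∀ i, side n c i ⊆ range fun y : ℝ => y • τ i + c i • n i := by
    intro i x hxs
    refine ⟨inner ℝ (τ i) x, ?_⟩
    have h1 := hx i x
    have h2 : inner ℝ (n i) x = c i := by
      have := hxs.2; rw [slack] at this; linarith
    rw [h2] at h1
    exact h1.symm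
  have hν : ∀ i, ν i = ((volume : Measure ℝ).restrict
      ((fun y : ℝ => y • τ i + c i • n i) ⁻¹' side n c i)).map
        (fun y : ℝ => y • τ i + c i • n i) := by
    intro i
    rw [← Measure.restrict_map (hiso i).continuous.measurable (isClosed_side n c i).measurableSet,
      ← hausdorffMeasure_real, (hiso i).map_hausdorffMeasure (Or.inl zero_le_one),
      Measure.restrict_restrict (isClosed_side n c i).measurableSet,
      inter_eq_left.2 (hsub i)]
  -- Possible overlaps of sides are harmless, since only an upper bound is sought.
  have hle : boundaryMeasure (polygon n c) ≤ Measure.sum ν :=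
    (Measure.restrict_mono (frontier_polygon_subset n c) le_rfl).trans Measure.restrict_iUnion_le
  have hcc : ∀ i, Integrable (fun y : ℝ => f (y • τ i + c i • n i)) := fun i =>
    (hf.comp (hiso i).continuous).integrable_of_hasCompactSupport
      (hfc.comp_isClosedEmbedding (hiso i).isClosedEmbedding)
  have hint : ∀ i, Integrable f (ν i) := by
    intro i
    rw [hν, integrable_map_measure hf.aestronglyMeasurable (hiso i).continuous.aemeasurable]
    exact (hcc i).restrict
  rw [Measure.sum_fintype] at hle
  have hsumint : Integrable f (∑ i, ν i) := integrable_finsetSum_measure.2 fun i _ => hint i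
  refine (integral_mono_measure hle (Eventually.of_forall hf0) hsumint).trans ?_
  rw [integral_finsetSum_measure fun i _ => hint i]
  refine Finset.sum_le_sum fun i _ => ?_
  rw [hν, integral_map (hiso i).continuous.aemeasurable hf.aestronglyMeasurable,
    ← integral_indicator ((isClosed_side n c i).preimage (hiso i).continuous).measurableSet]
  refine le_of_eq (integral_congr_ae ?_)
  filter_upwards [ae_slack_ne_zero hn hinj hne i (hx i)] with y hy
  by_cases hys : y • τ i + c i • n i ∈ side n c i
  · rw [indicator_of_mem (by exact hys), Finset.prod_eq_one, mul_one]
    intro k hk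
    exact if_pos (lt_of_le_of_ne (hys.1 k) (hy k (Finset.ne_of_mem_erase hk)).symm)
  · rw [indicator_of_notMem (by exact hys)]
    have h0 : slack n c i (y • τ i + c i • n i) = 0 := by
      simp only [slack, inner_add_right, inner_smul_right, real_inner_self_eq_norm_sq, hn,
        real_inner_comm (τ i), hτn]
      ring
    have : ∃ k, ¬ 0 ≤ slack n c k (y • τ i + c i • n i) := by
      by_contra h
      push Not at h
      exact hys ⟨h, h0⟩
    obtain ⟨k, hk⟩ := this
    have hki : k ≠ i := by
      rintro rfl
      exact hk h0.ge
    rw [Finset.prod_eq_zero (Finset.mem_erase.2 ⟨hki, Finset.mem_univ k⟩)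
      (if_neg fun h => hk h.le), mul_zero]

/-- A vector field pointing outwards on the boundary of a polygon controls boundary integrals. -/
theorem integral_boundary_le_integral_divergence {n : ι → Plane} {c : ι → ℝ}
    (hn : ∀ i, ‖n i‖ = 1) (hinj : Function.Injective fun i => (n i, c i))
    (hne : (polygon n c).Nonempty) {β : ℝ} {V : Plane → Plane} (hV : ContDiff ℝ ∞ V)
    (hβ : ∀ i, ∀ x ∈ side n c i, β ≤ inner ℝ (n i) (V x)) {f : Plane → ℝ} (hβ0 : 0 ≤ β)
    (hf : ContDiff ℝ ∞ f) (hfc : HasCompactSupport f) (hf0 : ∀ x, 0 ≤ f x) :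
    β * ∫ x, f x ∂(boundaryMeasure (polygon n c)) ≤
      ∫ x in polygon n c, divergence (fun y => f y • V y) x := by
  choose τ hτ hτn hx hm using fun i => exists_orthonormal_frame (hn i)
  rw [integral_divergence_polygon hn hinj hne hτ hτn hx hm (X := fun y => f y • V y)
    (hf.smul hV) hfc.smul_right]
  refine (mul_le_mul_of_nonneg_left (integral_boundaryMeasure_polygon_le hn hinj hne hτ hτn hx
    hf.continuous hfc hf0) hβ0).trans ?_
  rw [Finset.mul_sum]
  refine Finset.sum_le_sum fun i _ => ?_
  have hiso : Isometry fun y : ℝ => y • τ i + c i • n i := by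
    refine Isometry.of_dist_eq fun y z => ?_
    rw [dist_add_right, dist_eq_norm, ← sub_smul, norm_smul, hτ i, mul_one, Real.dist_eq,
      Real.norm_eq_abs]
  have hmeas : Measurable fun y : ℝ => ∏ k ∈ Finset.univ.erase i,
      (if 0 < slack n c k (y • τ i + c i • n i) then (1 : ℝ) else 0) := by
    refine Finset.measurable_fun_prod _ fun k _ => ?_
    refine Measurable.ite ?_ measurable_const measurable_const
    exact (isOpen_lt continuous_const ((continuous_slack n c k).comp
      hiso.continuous)).measurableSet
  have hbound : ∀ y : ℝ, ‖∏ k ∈ Finset.univ.erase i,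
      (if 0 < slack n c k (y • τ i + c i • n i) then (1 : ℝ) else 0)‖ ≤ 1 := by
    intro y
    rw [Real.norm_of_nonneg (Finset.prod_nonneg fun k _ => by split_ifs <;> norm_num)]
    exact Finset.prod_le_one (fun k _ => by split_ifs <;> norm_num)
      (fun k _ => by split_ifs <;> norm_num)
  have hint : ∀ F : Plane → ℝ, Continuous F → HasCompactSupport F →
      Integrable fun y : ℝ => F (y • τ i + c i • n i) * ∏ k ∈ Finset.univ.erase i,
        (if 0 < slack n c k (y • τ i + c i • n i) then (1 : ℝ) else 0) := by
    intro F hF hFc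
    have : Integrable fun y : ℝ => F (y • τ i + c i • n i) :=
      (hF.comp hiso.continuous).integrable_of_hasCompactSupport
        (hFc.comp_isClosedEmbedding hiso.isClosedEmbedding)
    exact this.mul_bdd (c := 1) hmeas.aestronglyMeasurable (Eventually.of_forall hbound)
  rw [← integral_const_mul]
  refine integral_mono ((hint f hf.continuous hfc).const_mul β)
    (hint (fun x => inner ℝ (n i) (f x • V x))
      (continuous_const.inner (hf.continuous.smul hV.continuous)) ?_) fun y => ?_
  · exact (hfc.smul_right (f' := V)).comp_left (g := fun v => inner ℝ (n i) v) (by simp)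
  · simp only []
    -- Off the closed side some other slack is negative, so the product vanishes in both integrands;
    -- only there is no lower bound on the normal component known.
    by_cases hys : y • τ i + c i • n i ∈ side n c i
    · rw [← mul_assoc]
      refine mul_le_mul_of_nonneg_right ?_
        (Finset.prod_nonneg fun k _ => by split_ifs <;> norm_num)
      rw [inner_smul_right, mul_comm]
      exact mul_le_mul_of_nonneg_left (hβ i _ hys) (hf0 _)
    · have h0 : slack n c i (y • τ i + c i • n i) = 0 := by
        simp only [slack, inner_add_right, inner_smul_right, real_inner_self_eq_norm_sq, hn,
          real_inner_comm (τ i), hτn]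
        ring
      have : ∃ k, ¬ 0 ≤ slack n c k (y • τ i + c i • n i) := by
        by_contra h
        push Not at h
        exact hys ⟨h, h0⟩
      obtain ⟨k, hk⟩ := this
      have hki : k ≠ i := by
        rintro rfl
        exact hk h0.ge
      rw [Finset.prod_eq_zero (Finset.mem_erase.2 ⟨hki, Finset.mem_univ k⟩)
        (if_neg fun h => hk h.le)]
      simp

/-- The quadratic form inequality given by a vector field pointing outwards. -/
theorem quadratic_le_of_vectorField {n : ι → Plane} {c : ι → ℝ}
    (hn : ∀ i, ‖n i‖ = 1) (hinj : Function.Injective fun i => (n i, c i))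
    (hne : (polygon n c).Nonempty) {β s C : ℝ} (hβ0 : 0 ≤ β) (hs : 0 < s) {V : Plane → Plane}
    (hV : ContDiff ℝ ∞ V) (hβ : ∀ i, ∀ x ∈ side n c i, β ≤ inner ℝ (n i) (V x))
    {q : Plane → ℝ} (hq : Measurable q) (hqC : ∀ x, |q x| ≤ C)
    (hVq : ∀ x ∈ polygon n c, s⁻¹ * ‖V x‖ ^ 2 + divergence V x ≤ q x)
    {φ : Plane → ℝ} (hφ : ContDiff ℝ ∞ φ) (hφc : HasCompactSupport φ) :
    β * ∫ x, φ x ^ 2 ∂(boundaryMeasure (polygon n c)) ≤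
      s * (∫ x in polygon n c, ‖gradient φ x‖ ^ 2) + ∫ x in polygon n c, q x * φ x ^ 2 := by
  have hf : ContDiff ℝ ∞ fun x => φ x ^ 2 := hφ.pow 2
  have hfc : HasCompactSupport fun x => φ x ^ 2 :=
    hφc.comp_left (g := fun t : ℝ => t ^ 2) (by simp)
  refine (integral_boundary_le_integral_divergence hn hinj hne hV hβ hβ0 hf hfc
    fun x => sq_nonneg _).trans ?_
  have i1 : Integrable fun x => ‖gradient φ x‖ ^ 2 := by
    refine ((continuous_gradient hφ).norm.pow 2).integrable_of_hasCompactSupport ?_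
    have h1 : HasCompactSupport fun x => ‖fderiv ℝ φ x‖ := (hφc.fderiv (𝕜 := ℝ)).norm
    have h2 : HasCompactSupport fun x => ‖fderiv ℝ φ x‖ ^ 2 :=
      h1.comp_left (g := fun t : ℝ => t ^ 2) (by simp)
    simp only [norm_gradient_eq]
    exact h2
  have i0 : Integrable fun x => φ x ^ 2 := hf.continuous.integrable_of_hasCompactSupport hfc
  have i2 : Integrable fun x => q x * φ x ^ 2 :=
    i0.bdd_mul (c := C) hq.aestronglyMeasurable (Eventually.of_forall hqC)
  rw [← integral_const_mul, ← integral_add (i1.restrict.const_mul s) i2.restrict]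
  have hX : ContDiff ℝ ∞ fun y => φ y ^ 2 • V y := hf.smul hV
  have hXc : HasCompactSupport fun y => φ y ^ 2 • V y := hfc.smul_right
  have i3 : Integrable (divergence fun y => φ y ^ 2 • V y) :=
    (continuous_divergence hX).integrable_of_hasCompactSupport (hasCompactSupport_divergence hXc)
  refine setIntegral_mono_on i3.integrableOn ((i1.const_mul s).add i2).integrableOn
    (isOpen_polygon n c).measurableSet fun x hx => ?_
  · rw [divergence_smul (f := fun x => φ x ^ 2) hf hV]
    have h1 : fderiv ℝ (fun x => φ x ^ 2) x (V x) = 2 * φ x * inner ℝ (gradient φ x) (V x) := by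
      rw [inner_gradient_eq_fderiv, fderiv_fun_pow 2 (hφ.differentiable (by simp) x)]
      simp
    rw [h1]
    have h2 := hVq x hx
    have h3 := real_inner_le_norm (gradient φ x) (V x)
    -- Young's inequality with parameter `s`, from expanding s(|∇φ| - s⁻¹|V||φ|)² ≥ 0.
    have h4 : 2 * φ x * inner ℝ (gradient φ x) (V x) ≤
        s * ‖gradient φ x‖ ^ 2 + s⁻¹ * ‖V x‖ ^ 2 * φ x ^ 2 := by
      have h5 : φ x * inner ℝ (gradient φ x) (V x) ≤
          |φ x| * (‖gradient φ x‖ * ‖V x‖) := by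
        refine (le_abs_self _).trans ?_
        rw [abs_mul]
        gcongr
        exact abs_real_inner_le_norm _ _
      have h6 := mul_nonneg hs.le (sq_nonneg (‖gradient φ x‖ - s⁻¹ * (‖V x‖ * |φ x|)))
      have h7 : s * (‖gradient φ x‖ - s⁻¹ * (‖V x‖ * |φ x|)) ^ 2 =
          s * ‖gradient φ x‖ ^ 2 - 2 * (|φ x| * (‖gradient φ x‖ * ‖V x‖)) +
            s⁻¹ * ‖V x‖ ^ 2 * φ x ^ 2 := by
        rw [← sq_abs (φ x)]
        field_simp
        ring
      linarith
    have h8 := mul_le_mul_of_nonneg_right h2 (sq_nonneg (φ x))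
    linarith

end Polygon

/-! ### Corners of polygons -/

section Geometry

theorem inner_eq_coord (x y : Plane) : inner ℝ x y = x 0 * y 0 + x 1 * y 1 := by
  rw [PiLp.inner_apply, Fin.sum_univ_two]
  simp [mul_comm]

theorem norm_sq_eq_coord (x : Plane) : ‖x‖ ^ 2 = x 0 ^ 2 + x 1 ^ 2 := by
  rw [← real_inner_self_eq_norm_sq, inner_eq_coord]
  ring

theorem plane_ext {x y : Plane} (h0 : x 0 = y 0) (h1 : x 1 = y 1) : x = y := by
  ext j
  fin_cases j
  · exact h0
  · exact h1

/-- The determinant of two vectors of the plane. -/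
noncomputable def det₂ (a b : Plane) : ℝ := a 0 * b 1 - a 1 * b 0

theorem eq_or_eq_neg_of_det_eq_zero {a b : Plane} (ha : ‖a‖ = 1) (hb : ‖b‖ = 1)
    (h : det₂ a b = 0) : b = a ∨ b = -a := by
  have ha2 := norm_sq_eq_coord a
  have hb2 := norm_sq_eq_coord b
  rw [ha] at ha2
  rw [hb] at hb2
  rw [det₂] at h
  have h1 : (a 0 * b 0 + a 1 * b 1) ^ 2 = 1 := by
    have : (a 0 * b 0 + a 1 * b 1) ^ 2 + (a 0 * b 1 - a 1 * b 0) ^ 2 =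
      (a 0 ^ 2 + a 1 ^ 2) * (b 0 ^ 2 + b 1 ^ 2) := by ring
    rw [h, ← ha2, ← hb2] at this
    linarith
  have e0 : b 0 = a 0 * (a 0 * b 0 + a 1 * b 1) := by
    linear_combination b 0 * ha2 - a 1 * h
  have e1 : b 1 = a 1 * (a 0 * b 0 + a 1 * b 1) := by
    linear_combination b 1 * ha2 + a 0 * h
  rcases mul_self_eq_one_iff.1 ((sq _).symm.trans h1) with h2 | h2
  · left
    rw [h2] at e0 e1
    exact plane_ext (by linarith) (by linarith)
  · right
    rw [h2] at e0 e1
    exact plane_ext (by simp; linarith) (by simp; linarith)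

variable {ι : Type*}

theorem closure_polygon [Fintype ι] {n : ι → Plane} {c : ι → ℝ} (hne : (polygon n c).Nonempty) :
    closure (polygon n c) = closedPolygon n c := by
  refine subset_antisymm (closure_minimal (polygon_subset_closedPolygon n c)
    (isClosed_closedPolygon n c)) fun x hx => ?_
  obtain ⟨p, hp⟩ := hne
  have h1 : Tendsto (fun m : ℕ => x + (1 / ((m : ℝ) + 1)) • (p - x)) atTop
      (𝓝 (x + (0 : ℝ) • (p - x))) :=
    tendsto_const_nhds.add (tendsto_one_div_add_atTop_nhds_zero_nat.smul_const _)
  rw [zero_smul, add_zero] at h1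
  refine mem_closure_of_tendsto h1 (Eventually.of_forall fun m i => ?_)
  have hm : (0 : ℝ) < 1 / ((m : ℝ) + 1) := Nat.one_div_pos_of_nat
  have hm1 : 1 / ((m : ℝ) + 1) ≤ 1 := by
    rw [div_le_one (by positivity)]
    linarith [Nat.cast_nonneg (α := ℝ) m]
  set t := 1 / ((m : ℝ) + 1)
  have h2 : slack n c i (x + t • (p - x)) = (1 - t) * slack n c i x + t * slack n c i p := by
    simp only [slack, inner_add_right, inner_smul_right, inner_sub_right]
    ring
  rw [h2]
  have := mul_nonneg (sub_nonneg.2 hm1) (hx i)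
  have := mul_pos hm (hp i)
  linarith

/-- Slacks are affine and nonnegative on the polygon, so if one vanishes inside a segment it
vanishes at both ends; two non-parallel lines share only one point. -/
theorem mem_extremePoints_closedPolygon {n : ι → Plane} {c : ι → ℝ} {i k : ι}
    (hd : det₂ (n i) (n k) ≠ 0) {q : Plane} (hq : q ∈ closedPolygon n c)
    (hi : slack n c i q = 0) (hk : slack n c k q = 0) :
    q ∈ extremePoints ℝ (closedPolygon n c) := by
  rw [mem_extremePoints]
  refine ⟨hq, fun x hx y hy hs => ?_⟩
  obtain ⟨a, b, ha, hb, hab, rfl⟩ := hs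
  have hz : ∀ j, slack n c j (a • x + b • y) = 0 → slack n c j x = 0 ∧ slack n c j y = 0 := by
    intro j hj
    have h1 : slack n c j (a • x + b • y) = a * slack n c j x + b * slack n c j y := by
      simp only [slack, inner_add_right, inner_smul_right]
      linear_combination -c j * hab
    rw [h1] at hj
    have h2 := mul_nonneg ha.le (hx j)
    have h3 := mul_nonneg hb.le (hy j)
    constructor
    · have : a * slack n c j x = 0 := by linarith
      exact (mul_eq_zero.1 this).resolve_left ha.ne'
    · have : b * slack n c j y = 0 := by linarith
      exact (mul_eq_zero.1 this).resolve_left hb.ne'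
  have huniq : ∀ z w : Plane, slack n c i z = 0 → slack n c k z = 0 → slack n c i w = 0 →
      slack n c k w = 0 → z = w := by
    intro z w h1 h2 h3 h4
    simp only [slack, inner_eq_coord] at h1 h2 h3 h4
    refine plane_ext (mul_left_cancel₀ hd ?_) (mul_left_cancel₀ hd ?_)
    · rw [det₂]
      linear_combination n k 1 * (h3 - h1) - n i 1 * (h4 - h2)
    · rw [det₂]
      linear_combination n i 0 * (h4 - h2) - n k 0 * (h3 - h1)
  exact ⟨huniq _ _ (hz i hi).1 (hz k hk).1 hi hk, huniq _ _ (hz i hi).2 (hz k hk).2 hi hk⟩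

/-- Distinct parallel lines cannot both be arbitrarily close to a point of the closed polygon. For
transversal lines, smallness of both slacks forces closeness to the intersection point `q`, which is
either a vertex or at positive distance from the closed polygon. -/
theorem exists_near_extremePoint_pair [Fintype ι] {n : ι → Plane} {c : ι → ℝ}
    (hn : ∀ i, ‖n i‖ = 1)
    (hinj : Function.Injective fun i => (n i, c i)) (hne : (polygon n c).Nonempty) {i k : ι}
    (hik : i ≠ k) {δ : ℝ} (hδ : 0 < δ) :
    ∃ η > 0, ∀ x ∈ closedPolygon n c, slack n c i x ≤ η → slack n c k x ≤ η →
      ∃ P ∈ extremePoints ℝ (closedPolygon n c), ‖x - P‖ ≤ δ := by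
  by_cases hd : det₂ (n i) (n k) = 0
  · rcases eq_or_eq_neg_of_det_eq_zero (hn i) (hn k) hd with h | h
    · have hc : 0 < |c i - c k| := by
        refine abs_pos.2 fun h0 => hik (hinj ?_)
        simp only [h, Prod.mk.injEq, true_and]
        linarith
      refine ⟨|c i - c k| / 2, by positivity, fun x hx h1 h2 => ?_⟩
      exfalso
      have h3 := hx i
      have h4 := hx k
      have h5 : slack n c i x - slack n c k x = c i - c k := by
        simp only [slack, h]
        ring
      have : |c i - c k| ≤ |c i - c k| / 2 := by
        conv_lhs => rw [← h5]
        rw [abs_le]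
        constructor <;> linarith
      linarith
    · obtain ⟨p, hp⟩ := hne
      have h5 : ∀ x, slack n c i x + slack n c k x = c i + c k := by
        intro x
        simp only [slack, h, inner_neg_left]
        ring
      have hpos : 0 < c i + c k := by
        rw [← h5 p]
        exact add_pos (hp i) (hp k)
      refine ⟨(c i + c k) / 3, by positivity, fun x hx h1 h2 => ?_⟩
      exfalso
      have := h5 x
      linarith
  · set D := det₂ (n i) (n k) with hD
    -- Cramer's rule for the intersection of the two lines.
    set q : Plane := !₂[(c i * n k 1 - c k * n i 1) / D, (c k * n i 0 - c i * n k 0) / D] with hq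
    have q0 : q 0 = (c i * n k 1 - c k * n i 1) / D := by simp [hq]
    have q1 : q 1 = (c k * n i 0 - c i * n k 0) / D := by simp [hq]
    have hqi : slack n c i q = 0 := by
      rw [slack, inner_eq_coord, q0, q1]
      field_simp
      rw [hD, det₂]
      ring
    have hqk : slack n c k q = 0 := by
      rw [slack, inner_eq_coord, q0, q1]
      field_simp
      rw [hD, det₂]
      ring
    have hDpos : 0 < |D| := abs_pos.2 hd
    have hcoord : ∀ j (l : Fin 2), |n j l| ≤ 1 := fun j l => by
      have := PiLp.norm_apply_le (p := 2) (n j) l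
      rwa [hn] at this
    have hclose : ∀ η > 0, ∀ x ∈ closedPolygon n c, slack n c i x ≤ η → slack n c k x ≤ η →
        ‖x - q‖ ≤ 4 * η / |D| := by
      intro η hη x hx h1 h2
      have h3 := hx i
      have h4 := hx k
      have e0 : D * (x - q) 0 = n i 1 * slack n c k x - n k 1 * slack n c i x := by
        have h5 : D * (x - q) 0 = D * x 0 - D * q 0 := by simp; ring
        rw [h5, q0, mul_div_cancel₀ _ hd]
        simp only [slack, inner_eq_coord]
        rw [hD, det₂]
        ring
      have e1 : D * (x - q) 1 = n k 0 * slack n c i x - n i 0 * slack n c k x := by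
        have h5 : D * (x - q) 1 = D * x 1 - D * q 1 := by simp; ring
        rw [h5, q1, mul_div_cancel₀ _ hd]
        simp only [slack, inner_eq_coord]
        rw [hD, det₂]
        ring
      have b : ∀ s t : ℝ, |s| ≤ 1 → |t| ≤ 1 →
          |s * slack n c k x - t * slack n c i x| ≤ 2 * η := by
        intro s t hs ht
        refine (abs_sub _ _).trans ?_
        rw [abs_mul, abs_mul, abs_of_nonneg h3, abs_of_nonneg h4]
        nlinarith [abs_nonneg s, abs_nonneg t]
      have b0 : |(x - q) 0| ≤ 2 * η / |D| := by
        rw [le_div_iff₀ hDpos, mul_comm, ← abs_mul, e0]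
        exact b _ _ (hcoord i 1) (hcoord k 1)
      have b1 : |(x - q) 1| ≤ 2 * η / |D| := by
        rw [le_div_iff₀ hDpos, mul_comm, ← abs_mul, e1, abs_sub_comm]
        exact b _ _ (hcoord i 0) (hcoord k 0)
      have hnorm : ‖x - q‖ ≤ |(x - q) 0| + |(x - q) 1| := by
        refine abs_le_of_sq_le_sq' ?_ (by positivity) |>.2
        rw [norm_sq_eq_coord, ← sq_abs ((x - q) 0), ← sq_abs ((x - q) 1)]
        nlinarith [abs_nonneg ((x - q) 0), abs_nonneg ((x - q) 1)]
      calc ‖x - q‖ ≤ 2 * η / |D| + 2 * η / |D| := hnorm.trans (add_le_add b0 b1)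
        _ = 4 * η / |D| := by ring
    by_cases hqc : q ∈ closedPolygon n c
    · refine ⟨δ * |D| / 4, by positivity, fun x hx h1 h2 => ⟨q,
        mem_extremePoints_closedPolygon hd hqc hqi hqk, ?_⟩⟩
      refine (hclose _ (by positivity) x hx h1 h2).trans (le_of_eq ?_)
      field_simp
    · obtain ⟨r, hr, hball⟩ := Metric.isOpen_iff.1 (isClosed_closedPolygon n c).isOpen_compl q hqc
      refine ⟨r * |D| / 8, by positivity, fun x hx h1 h2 => ?_⟩
      exfalso
      have h3 := hclose _ (by positivity) x hx h1 h2
      refine hball (mem_ball_iff_norm.2 (h3.trans_lt ?_)) hx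
      have : 4 * (r * |D| / 8) / |D| = r / 2 := by
        field_simp
        norm_num
      rw [this]
      exact half_lt_self hr

theorem exists_near_extremePoint [Fintype ι] {n : ι → Plane} {c : ι → ℝ} (hn : ∀ i, ‖n i‖ = 1)
    (hinj : Function.Injective fun i => (n i, c i)) (hne : (polygon n c).Nonempty)
    {δ : ℝ} (hδ : 0 < δ) :
    ∃ η > 0, ∀ i k, i ≠ k → ∀ x ∈ closedPolygon n c, slack n c i x ≤ η → slack n c k x ≤ η →
      ∃ P ∈ extremePoints ℝ (closedPolygon n c), ‖x - P‖ ≤ δ := by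
  classical
  have h : ∀ z : ι × ι, ∃ η > 0, z.1 ≠ z.2 → ∀ x ∈ closedPolygon n c, slack n c z.1 x ≤ η →
      slack n c z.2 x ≤ η → ∃ P ∈ extremePoints ℝ (closedPolygon n c), ‖x - P‖ ≤ δ := by
    intro z
    by_cases hz : z.1 = z.2
    · exact ⟨1, one_pos, fun h => absurd hz h⟩
    · obtain ⟨η, h1, h2⟩ := exists_near_extremePoint_pair hn hinj hne hz hδ
      exact ⟨η, h1, fun _ => h2⟩
  choose η hη H using h
  obtain ⟨η₀, h0, hle⟩ : ∃ η₀ > 0, ∀ z, η₀ ≤ η z := by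
    rcases isEmpty_or_nonempty (ι × ι) with he | he
    · exact ⟨1, one_pos, fun z => (he.false z).elim⟩
    · obtain ⟨z, hz⟩ := Finite.exists_min η
      exact ⟨η z, hη z, hz⟩
  exact ⟨η₀, h0, fun i k hik x hx h1 h2 => H (i, k) hik x hx (h1.trans (hle _))
    (h2.trans (hle _))⟩

/-- Normalizing the normals and indexing by the finite set of resulting pairs removes repeated
half-planes, which would otherwise make a side count twice and break injectivity. -/
theorem exists_polygon_of_isConvexPolygonalDomain {Ω : Set Plane}
    (h : IsConvexPolygonalDomain Ω) :
    ∃ (ι : Type) (_ : Fintype ι) (n : ι → Plane) (c : ι → ℝ), (∀ i, ‖n i‖ = 1) ∧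
      (Function.Injective fun i => (n i, c i)) ∧ (polygon n c).Nonempty ∧ Ω = polygon n c := by
  classical
  obtain ⟨hne, m, n, c, hn, rfl⟩ := h
  set S : Finset (Plane × ℝ) :=
    Finset.univ.image fun i => (‖n i‖⁻¹ • n i, ‖n i‖⁻¹ * c i) with hS
  have heq : {x | ∀ i, inner ℝ (n i) x < c i} =
      polygon (fun z : S => z.1.1) (fun z : S => z.1.2) := by
    ext x
    have key : ∀ i, inner ℝ (n i) x < c i ↔
        0 < ‖n i‖⁻¹ * c i - inner ℝ (‖n i‖⁻¹ • n i) x := by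
      intro i
      have h0 : 0 < ‖n i‖⁻¹ := inv_pos.2 (norm_pos_iff.2 (hn i))
      rw [inner_smul_left, RCLike.conj_to_real, ← mul_sub, mul_pos_iff_of_pos_left h0, sub_pos]
    simp only [polygon, slack, mem_ofPred_eq, Subtype.forall]
    constructor
    · intro hx z hz
      obtain ⟨i, -, rfl⟩ := Finset.mem_image.1 hz
      exact (key i).1 (hx i)
    · intro hx i
      exact (key i).2 (hx _ (Finset.mem_image_of_mem _ (Finset.mem_univ i)))
  refine ⟨S, inferInstance, fun z => z.1.1, fun z => z.1.2, ?_, ?_, heq ▸ hne, heq⟩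
  · rintro ⟨z, hz⟩
    obtain ⟨i, -, rfl⟩ := Finset.mem_image.1 hz
    rw [norm_smul, norm_inv, norm_norm, inv_mul_cancel₀ (norm_ne_zero_iff.2 (hn i))]
  · intro z w hzw
    exact Subtype.ext hzw

theorem smul_polygon (n : ι → Plane) (c : ι → ℝ) {L : ℝ} (hL : 0 < L) :
    L • polygon n c = polygon n (fun i => L * c i) := by
  ext x
  rw [mem_smul_set_iff_inv_smul_mem₀ hL.ne']
  simp only [polygon, mem_ofPred_eq]
  refine forall_congr' fun i => ?_
  have : slack n (fun i => L * c i) i x = L * slack n c i (L⁻¹ • x) := by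
    simp only [slack, inner_smul_right]
    field_simp
  rw [this, mul_pos_iff_of_pos_left hL]

end Geometry

/-! ### The outward vector field and lower bounds for the Robin form -/

section VectorField

theorem exists_lipschitzWith_sum {κ : Type*} (s : Finset κ) {f : κ → Plane → Plane}
    (h : ∀ i, ∃ K, LipschitzWith K (f i)) :
    ∃ K, LipschitzWith K fun x => ∑ i ∈ s, f i x := by
  classical
  induction s using Finset.induction_on with
  | empty => exact ⟨0, by simp⟩
  | insert i s hi ih =>
    obtain ⟨K, hK⟩ := ih
    obtain ⟨K', hK'⟩ := h i
    refine ⟨K' + K, ?_⟩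
    simp_rw [Finset.sum_insert hi]
    exact hK'.add hK

variable {ι : Type*} [Fintype ι]

/-- A smooth vector field on a polygon whose normal component on the boundary is at least `β`
and whose length is at most `β` away from the corners. -/
theorem exists_vectorField {n : ι → Plane} {c : ι → ℝ} (hn : ∀ i, ‖n i‖ = 1)
    (hinj : Function.Injective fun i => (n i, c i)) (hne : (polygon n c).Nonempty)
    {N : ℕ} {B : Fin N → Plane} (hB : range B = extremePoints ℝ (closedPolygon n c))
    {β δ : ℝ} (hβ : 0 ≤ β) (hδ : 0 < δ) :
    ∃ (V : Plane → Plane) (K : NNReal) (C : ℝ), ContDiff ℝ ∞ V ∧ LipschitzWith K V ∧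
      (∀ x, ‖V x‖ ≤ C) ∧ (∀ i, ∀ x ∈ side n c i, β ≤ inner ℝ (n i) (V x)) ∧
      ∀ x ∈ closedPolygon n c, (∀ j, δ < ‖x - B j‖) → ‖V x‖ ≤ β := by
  classical
  obtain ⟨η, hη, hcor⟩ := exists_near_extremePoint hn hinj hne (half_pos hδ)
  obtain ⟨p, hp⟩ := hne
  let θ₀ : ContDiffBump (0 : ℝ) := ⟨1 / 2, 1, by norm_num, by norm_num⟩
  let ρ : (j : Fin N) → ContDiffBump (B j) := fun j => ⟨δ / 2, δ, half_pos hδ, half_lt_self hδ⟩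
  -- On side `i` the radial field `M • (x - p)` has normal component `M * slack n c i p`. This `M`
  -- makes it at least `β` times the number of sides, for all `i` at once.
  set M : ℝ := ∑ i, β * Fintype.card ι / slack n c i p with hM
  have hMt : ∀ i, 0 ≤ β * Fintype.card ι / slack n c i p := fun i =>
    div_nonneg (by positivity) (hp i).le
  have hM0 : 0 ≤ M := Finset.sum_nonneg fun i _ => hMt i
  have hMi : ∀ i, β * Fintype.card ι ≤ M * slack n c i p := by
    intro i
    rw [← div_le_iff₀ (hp i)]
    exact Finset.single_le_sum (f := fun i => β * Fintype.card ι / slack n c i p)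
      (fun i _ => hMt i) (Finset.mem_univ i)
  set θ : ι → Plane → ℝ := fun i x => θ₀ (slack n c i x / η) with hθ
  set κ : Plane → ℝ := fun x => ∑ j, ρ j x with hκ
  have hθs : ∀ i, ContDiff ℝ ∞ (θ i) := fun i =>
    θ₀.contDiff.comp ((contDiff_slack n c i).div_const _)
  have hθ0 : ∀ i x, 0 ≤ θ i x := fun i x => θ₀.nonneg
  have hθ1 : ∀ i x, θ i x ≤ 1 := fun i x => θ₀.le_one
  have hθz : ∀ i x, η < slack n c i x → θ i x = 0 := by
    intro i x hx
    refine θ₀.zero_of_le_dist ?_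
    rw [dist_zero_right]
    exact ((one_le_div hη).2 hx.le).trans (le_abs_self _)
  have hθside : ∀ i, ∀ x ∈ side n c i, θ i x = 1 := by
    intro i x hx
    refine θ₀.one_of_mem_closedBall ?_
    rw [hx.2, zero_div]
    exact Metric.mem_closedBall_self (by norm_num)
  have hκs : ContDiff ℝ ∞ κ := ContDiff.sum fun j _ => (ρ j).contDiff
  have hκ0 : ∀ x, 0 ≤ κ x := fun x => Finset.sum_nonneg fun j _ => (ρ j).nonneg
  have hκ1 : ∀ x, (∃ P ∈ extremePoints ℝ (closedPolygon n c), ‖x - P‖ ≤ δ / 2) → 1 ≤ κ x := by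
    rintro x ⟨P, hP, hx⟩
    rw [← hB] at hP
    obtain ⟨j, rfl⟩ := hP
    have h1 : ρ j x = 1 := (ρ j).one_of_mem_closedBall (mem_closedBall_iff_norm.2 hx)
    rw [← h1]
    exact Finset.single_le_sum (f := fun j => ρ j x) (fun j _ => (ρ j).nonneg)
      (Finset.mem_univ j)
  have hκz : ∀ x, (∀ j, δ < ‖x - B j‖) → κ x = 0 := by
    intro x hx
    refine Finset.sum_eq_zero fun j _ => (ρ j).zero_of_le_dist ?_
    rw [dist_eq_norm]
    exact (hx j).le
  have hκc : HasCompactSupport κ := by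
    refine HasCompactSupport.intro
      (isCompact_iUnion fun j => isCompact_closedBall (B j) δ) fun x hx => hκz x fun j => ?_
    by_contra h
    exact hx (mem_iUnion.2 ⟨j, mem_closedBall_iff_norm.2 (not_lt.1 h)⟩)
  set W : Plane → Plane := fun x => κ x • (M • (x - p)) with hW
  have hWs : ContDiff ℝ ∞ W := hκs.smul (by fun_prop)
  have hWc : HasCompactSupport W := hκc.smul_right
  set U : Plane → Plane := fun x => ∑ i, (β * θ i x) • n i with hU
  have hUs : ContDiff ℝ ∞ U := ContDiff.sum fun i _ =>
    (contDiff_const.mul (hθs i)).smul contDiff_const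
  obtain ⟨KW, hKW⟩ := hWs.lipschitzWith_of_hasCompactSupport hWc (by simp)
  obtain ⟨CW, hCW⟩ := hWc.exists_bound_of_continuous hWs.continuous
  obtain ⟨KU, hKU⟩ : ∃ K, LipschitzWith K U := by
    refine exists_lipschitzWith_sum _ fun i => ?_
    obtain ⟨K₀, hK₀⟩ := (θ₀.contDiff (n := 1)).lipschitzWith_of_hasCompactSupport
      θ₀.hasCompactSupport one_ne_zero
    have h1 : LipschitzWith (Real.toNNReal η⁻¹) fun x => slack n c i x / η := by
      refine LipschitzWith.of_dist_le_mul fun x y => ?_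
      rw [Real.coe_toNNReal _ (inv_pos.2 hη).le, Real.dist_eq, ← sub_div, abs_div, abs_of_pos hη,
        div_eq_inv_mul]
      refine mul_le_mul_of_nonneg_left ?_ (inv_pos.2 hη).le
      have : slack n c i x - slack n c i y = inner ℝ (n i) (y - x) := by
        rw [inner_sub_right]; simp only [slack]; ring
      rw [this, dist_comm, dist_eq_norm]
      refine (abs_real_inner_le_norm _ _).trans ?_
      rw [hn, one_mul]
    have h2 := (ContinuousLinearMap.toSpanSingleton ℝ (β • n i)).lipschitz.comp (hK₀.comp h1)
    have h3 : (fun x => (β * θ i x) • n i) =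
        ContinuousLinearMap.toSpanSingleton ℝ (β • n i) ∘ (θ₀ ∘ fun x => slack n c i x / η) := by
      funext x
      simp [hθ, smul_smul, mul_comm]
    exact ⟨_, h3 ▸ h2⟩
  have hUb : ∀ x, ‖U x‖ ≤ β * Fintype.card ι := by
    intro x
    refine (norm_sum_le _ _).trans ?_
    rw [mul_comm, ← nsmul_eq_mul, ← Finset.card_univ]
    refine Finset.sum_le_card_nsmul _ _ _ fun i _ => ?_
    rw [norm_smul, hn, mul_one, Real.norm_of_nonneg (mul_nonneg hβ (hθ0 i x))]
    exact mul_le_of_le_one_right hβ (hθ1 i x)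
  refine ⟨fun x => U x + W x, KU + KW, β * Fintype.card ι + CW, hUs.add hWs, hKU.add hKW,
    fun x => (norm_add_le _ _).trans (add_le_add (hUb x) (hCW x)), ?_, ?_⟩
  · intro i x hx
    have hWi : inner ℝ (n i) (W x) = κ x * (M * slack n c i p) := by
      have h1 : inner ℝ (n i) x = c i := by
        have := hx.2; rw [slack] at this; linarith
      simp only [hW, inner_smul_right, inner_sub_right, h1, slack]
    rw [inner_add_right, hWi]
    -- If a second side is close, then `x` is close to a vertex, where `κ ≥ 1`, and the radial part
    -- outweighs the at most `β` lost to each other normal. Otherwise only the `i`-th term of `U`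
    -- survives, and it contributes exactly `β`.
    by_cases hk : ∃ k, k ≠ i ∧ slack n c k x ≤ η
    · obtain ⟨k, hki, hk⟩ := hk
      have h1 := hκ1 x (hcor i k hki.symm x hx.1 (hx.2.trans_le hη.le) hk)
      have h2 : 1 * (β * Fintype.card ι) ≤ κ x * (M * slack n c i p) :=
        mul_le_mul h1 (hMi i) (by positivity) (hκ0 x)
      have h3 : inner ℝ (n i) (U x) = β + ∑ k ∈ Finset.univ.erase i,
          (β * θ k x) * inner ℝ (n i) (n k) := by
        simp only [hU, inner_sum, inner_smul_right]
        rw [← Finset.add_sum_erase _ _ (Finset.mem_univ i), hθside i x hx,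
          real_inner_self_eq_norm_sq, hn]
        ring
      have h4 : -(β * Fintype.card ι) ≤ ∑ k ∈ Finset.univ.erase i,
          (β * θ k x) * inner ℝ (n i) (n k) := by
        have h5 : ∀ k ∈ Finset.univ.erase i, -β ≤ (β * θ k x) * inner ℝ (n i) (n k) := by
          intro k _
          have h6 : |(β * θ k x) * inner ℝ (n i) (n k)| ≤ β := by
            rw [abs_mul, abs_of_nonneg (mul_nonneg hβ (hθ0 k x))]
            have h7 := abs_real_inner_le_norm (n i) (n k)
            rw [hn, hn, one_mul] at h7
            calc _ ≤ (β * 1) * 1 := by gcongr; exact hθ1 k x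
              _ = β := by ring
          exact (abs_le.1 h6).1
        have h6 := Finset.card_nsmul_le_sum _ _ _ h5
        rw [nsmul_eq_mul] at h6
        have h7 : ((Finset.univ.erase i).card : ℝ) ≤ Fintype.card ι := by
          exact_mod_cast Finset.card_le_univ _
        nlinarith
      linarith
    · push Not at hk
      have h1 : inner ℝ (n i) (U x) = β := by
        simp only [hU, inner_sum, inner_smul_right]
        rw [Finset.sum_eq_single i]
        · rw [hθside i x hx, real_inner_self_eq_norm_sq, hn]
          ring
        · intro k _ hki
          rw [hθz k x (hk k hki)]
          ring
        · simp
      rw [h1]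
      have := mul_nonneg (hκ0 x) (mul_nonneg hM0 (hp i).le)
      linarith
  · intro x hx hfar
    have hW0 : W x = 0 := by simp only [hW, hκz x hfar, zero_smul]
    simp only [hW0, add_zero]
    -- Far from the vertices at most one side is within `η`, so `U` has at most one nonzero term, of
    -- length at most `β`.
    by_cases h : ∃ i, slack n c i x ≤ η
    · obtain ⟨i, hi⟩ := h
      have h1 : U x = (β * θ i x) • n i := by
        refine Finset.sum_eq_single i (fun k _ hki => ?_) (by simp)
        rw [hθz k x, mul_zero, zero_smul]
        by_contra hk
        obtain ⟨P, hP, hxP⟩ := hcor i k hki.symm x hx hi (not_lt.1 hk)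
        rw [← hB] at hP
        obtain ⟨j, rfl⟩ := hP
        linarith [hfar j]
      rw [h1, norm_smul, hn, mul_one, Real.norm_of_nonneg (mul_nonneg hβ (hθ0 i x))]
      exact mul_le_of_le_one_right hβ (hθ1 i x)
    · push Not at h
      have h1 : U x = 0 := Finset.sum_eq_zero fun i _ => by
        rw [hθz i x (h i), mul_zero, zero_smul]
      rw [h1, norm_zero]
      exact hβ

variable [DecidableEq ι]

/-- Lower bounds for the Robin form on large dilations of a polygon. -/
theorem exists_robin_bound {n : ι → Plane} {c : ι → ℝ} (hn : ∀ i, ‖n i‖ = 1)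
    (hinj : Function.Injective fun i => (n i, c i)) (hne : (polygon n c).Nonempty)
    {N : ℕ} {B : Fin N → Plane} (hB : range B = vertices (polygon n c))
    {β δ : ℝ} (hβ : 0 ≤ β) (hδ : 0 < δ) :
    ∃ C ≥ 0, ∀ L > 0, ∀ (w : Plane → ℝ) (G : Plane → Plane) (g : Plane → ℝ),
      HasTrace (L • polygon n c) w G g →
      (β * ∫ x, g x ^ 2 ∂(boundaryMeasure (L • polygon n c)) ≤
        (∫ x in L • polygon n c, ‖G x‖ ^ 2) + ∫ x in L • polygon n c, (β ^ 2 + C / L +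
          {x | ∃ j, ‖x - L • B j‖ ≤ δ * L}.indicator (fun _ => C) x) * w x ^ 2) ∧
      (β * ∫ x, g x ^ 2 ∂(boundaryMeasure (L • polygon n c)) ≤
        1 / 2 * (∫ x in L • polygon n c, ‖G x‖ ^ 2) +
          ∫ x in L • polygon n c, (C + C / L) * w x ^ 2) := by
  rw [vertices, closure_polygon hne] at hB
  obtain ⟨V, K, C₀, hV, hK, hC₀, hside, hfar⟩ := exists_vectorField hn hinj hne hB hβ hδ
  have hC₀0 : 0 ≤ C₀ := (norm_nonneg _).trans (hC₀ 0)
  -- The term `2 * K` covers the divergence, at most `2 * K / L` after dilation; `2 * C₀ ^ 2` covers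
  -- s⁻¹|V|² both for `s = 1` near the vertices and for `s = 1 / 2` everywhere.
  set C : ℝ := 2 * K + 2 * C₀ ^ 2 with hC
  have hC0 : 0 ≤ C := by positivity
  refine ⟨C, hC0, fun L hL w G g h => ?_⟩
  have hinj' : Function.Injective fun i => (n i, L * c i) := by
    intro i k hik
    simp only [Prod.mk.injEq] at hik
    exact hinj (Prod.ext hik.1 (mul_left_cancel₀ hL.ne' hik.2))
  have hne' : (polygon n fun i => L * c i).Nonempty := by
    rw [← smul_polygon n c hL]
    exact hne.smul_set
  set VL : Plane → Plane := fun x => V (L⁻¹ • x) with hVL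
  have hVLs : ContDiff ℝ ∞ VL := hV.comp (contDiff_const_smul _)
  have hVLK : LipschitzWith (K * Real.toNNReal L⁻¹) VL := by
    refine LipschitzWith.of_dist_le_mul fun x y => (hK.dist_le_mul _ _).trans (le_of_eq ?_)
    rw [NNReal.coe_mul, Real.coe_toNNReal _ (inv_pos.2 hL).le, dist_smul₀,
      Real.norm_of_nonneg (inv_pos.2 hL).le]
    ring
  have hdiv : ∀ x, divergence VL x ≤ 2 * K / L := by
    intro x
    have h1 := norm_fderiv_le_of_lipschitz ℝ hVLK (x₀ := x)
    rw [NNReal.coe_mul, Real.coe_toNNReal _ (inv_pos.2 hL).le] at h1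
    calc divergence VL x ≤ 2 * ‖fderiv ℝ VL x‖ :=
          (le_abs_self _).trans (abs_divergence_le hVLs x)
      _ ≤ 2 * (K * L⁻¹) := by gcongr
      _ = 2 * K / L := by ring
  have hslack : ∀ i x, slack n (fun i => L * c i) i x = L * slack n c i (L⁻¹ • x) := by
    intro i x
    simp only [slack, inner_smul_right]
    field_simp
  have hclosed : ∀ x ∈ closedPolygon n (fun i => L * c i), L⁻¹ • x ∈ closedPolygon n c := by
    intro x hx i
    have h1 := hx i
    rw [hslack] at h1
    exact nonneg_of_mul_nonneg_right h1 hL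
  have hside' : ∀ i, ∀ x ∈ side n (fun i => L * c i) i, β ≤ inner ℝ (n i) (VL x) := by
    intro i x hx
    refine hside i _ ⟨hclosed x hx.1, ?_⟩
    have h1 := hx.2
    rw [hslack] at h1
    exact (mul_eq_zero.1 h1).resolve_left hL.ne'
  have hKC : 2 * K / L ≤ C / L := by
    gcongr
    nlinarith [sq_nonneg C₀]
  have hVsq : ∀ x, ‖VL x‖ ^ 2 ≤ C₀ ^ 2 := fun x =>
    pow_le_pow_left₀ (norm_nonneg _) (hC₀ _) 2
  set S : Set Plane := {x | ∃ j, ‖x - L • B j‖ ≤ δ * L} with hS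
  have hSm : MeasurableSet S := by
    have : S = ⋃ j, {x | ‖x - L • B j‖ ≤ δ * L} := by
      ext x; simp [hS]
    rw [this]
    exact MeasurableSet.iUnion fun j =>
      (isClosed_le (by fun_prop) continuous_const).measurableSet
  have hCL : 0 ≤ C / L := by positivity
  rw [smul_polygon n c hL] at h ⊢
  constructor
  · set q : Plane → ℝ := fun x => β ^ 2 + C / L + S.indicator (fun _ => C) x with hq
    have hqm : Measurable q := measurable_const.add (measurable_const.indicator hSm)
    have hqS : ∀ x ∈ S, q x = β ^ 2 + C / L + C := fun x hx => by
      simp only [hq, indicator_of_mem hx]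
    have hqN : ∀ x ∉ S, q x = β ^ 2 + C / L := fun x hx => by
      simp only [hq, indicator_of_notMem hx, add_zero]
    have hqb : ∀ x, |q x| ≤ β ^ 2 + C / L + C := by
      intro x
      by_cases hx : x ∈ S
      · rw [hqS x hx, abs_of_nonneg (by positivity)]
      · rw [hqN x hx, abs_of_nonneg (by positivity)]
        linarith
    have := h.quadratic_le (s := 1) hqm hqb
      (fun φ hφ hφc => quadratic_le_of_vectorField hn hinj' hne' hβ one_pos hVLs hside'
        hqm hqb (fun x hx => ?_) hφ hφc)
    · rwa [one_mul] at this
    · rw [inv_one, one_mul]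
      have h1 := hdiv x
      by_cases hxS : x ∈ S
      · rw [hqS x hxS]
        have h2 := hVsq x
        have : C₀ ^ 2 ≤ C := by
          rw [hC]
          nlinarith [sq_nonneg C₀, K.coe_nonneg]
        nlinarith [sq_nonneg β]
      · rw [hqN x hxS]
        have h2 : ‖VL x‖ ≤ β := by
          refine hfar _ (hclosed x (polygon_subset_closedPolygon _ _ hx)) fun j => ?_
          by_contra hj
          refine hxS ⟨j, ?_⟩
          have h3 : x - L • B j = L • (L⁻¹ • x - B j) := by
            rw [smul_sub, smul_inv_smul₀ hL.ne']
          rw [h3, norm_smul, Real.norm_of_nonneg hL.le, mul_comm]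
          exact mul_le_mul_of_nonneg_right (not_lt.1 hj) hL.le
        have h3 := pow_le_pow_left₀ (norm_nonneg _) h2 2
        linarith
  · refine h.quadratic_le (s := 1 / 2) (C := C + C / L) (q := fun x => C + C / L)
      measurable_const (fun x => (abs_of_nonneg (by positivity)).le)
      (fun φ hφ hφc => quadratic_le_of_vectorField hn hinj' hne' (s := 1 / 2)
        (C := C + C / L) hβ (by norm_num) hVLs hside' measurable_const
        (fun x => (abs_of_nonneg (by positivity)).le) (fun x hx => ?_) hφ hφc)
    have h1 := hdiv x
    have h2 := hVsq x
    have : 2 * C₀ ^ 2 ≤ C := by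
      rw [hC]
      linarith [K.coe_nonneg]
    norm_num
    linarith

end VectorField

/-! ### Regularization and exponentials of Lipschitz weights -/

open scoped Convolution in
/-- A Lipschitz function is uniformly close to smooth functions with the same Lipschitz constant. -/
theorem exists_contDiff_lipschitzWith_near {f : Plane → ℝ} {K : NNReal} (hf : LipschitzWith K f) :
    ∃ g : Plane → ℝ, ContDiff ℝ ∞ g ∧ LipschitzWith K g ∧ ∀ x, |g x - f x| ≤ 1 := by
  -- A `K`-Lipschitz function varies by at most 1 over this mollification radius; the `+ 1` covers
  -- `K = 0`.
  have hr : (0 : ℝ) < 1 / (K + 1) := by positivity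
  let φ : ContDiffBump (0 : Plane) := ⟨1 / (K + 1) / 2, 1 / (K + 1), half_pos hr, half_lt_self hr⟩
  have hint : ∀ x, Integrable fun t => φ.normed volume t * f (x - t) := fun x =>
    (φ.continuous_normed.mul (hf.continuous.comp (continuous_const.sub continuous_id)))
      |>.integrable_of_hasCompactSupport φ.hasCompactSupport_normed.mul_right
  refine ⟨φ.normed volume ⋆[ContinuousLinearMap.lsmul ℝ ℝ, volume] f,
    φ.hasCompactSupport_normed.contDiff_convolution_left _ φ.contDiff_normed
      hf.continuous.locallyIntegrable, LipschitzWith.of_dist_le_mul fun x y => ?_, fun x => ?_⟩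
  · rw [Real.dist_eq]
    simp only [convolution, ContinuousLinearMap.lsmul_apply, smul_eq_mul]
    rw [← integral_sub (hint x) (hint y)]
    refine (abs_integral_le_integral_abs).trans ?_
    calc ∫ t, |φ.normed volume t * f (x - t) - φ.normed volume t * f (y - t)|
        ≤ ∫ t, φ.normed volume t * (K * dist x y) := by
          refine integral_mono ((hint x).sub (hint y)).abs
            (φ.integrable_normed.mul_const _) fun t => ?_
          simp only []
          rw [← mul_sub, abs_mul, abs_of_nonneg (φ.nonneg_normed t)]
          refine mul_le_mul_of_nonneg_left ?_ (φ.nonneg_normed t)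
          have := hf.dist_le_mul (x - t) (y - t)
          rwa [dist_sub_right, Real.dist_eq] at this
      _ = K * dist x y := by rw [integral_mul_const, φ.integral_normed, one_mul]
  · rw [← Real.dist_eq]
    refine φ.dist_normed_convolution_le hf.continuous.aestronglyMeasurable fun y hy => ?_
    refine (hf.dist_le_mul y x).trans ?_
    have h1 : dist y x ≤ 1 / (K + 1) := (Metric.mem_ball.1 hy).le
    calc (K : ℝ) * dist y x ≤ K * (1 / (K + 1)) := by gcongr
      _ ≤ 1 := by
        rw [mul_one_div, div_le_one (by positivity)]
        linarith

theorem lipschitzWith_exp_comp {f : Plane → ℝ} {K : NNReal} (hf : LipschitzWith K f) {M : ℝ}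
    (hM : ∀ x, f x ≤ M) :
    LipschitzWith (Real.toNNReal (Real.exp M) * K) fun x => Real.exp (f x) := by
  have key : ∀ x y, Real.exp (f x) - Real.exp (f y) ≤ Real.exp M * (K * dist x y) := by
    intro x y
    have h1 : Real.exp (f x) - Real.exp (f y) ≤ Real.exp (f x) * |f x - f y| := by
      have h2 := Real.add_one_le_exp (f y - f x)
      have h3 : Real.exp (f y) = Real.exp (f x) * Real.exp (f y - f x) := by
        rw [← Real.exp_add]; ring_nf
      rw [h3]
      have h4 := le_abs_self (f x - f y)
      have h5 := Real.exp_pos (f x)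
      nlinarith
    refine h1.trans ?_
    have h2 := hf.dist_le_mul x y
    rw [Real.dist_eq] at h2
    exact mul_le_mul (Real.exp_le_exp.2 (hM x)) h2 (abs_nonneg _) (Real.exp_pos _).le
  refine LipschitzWith.of_dist_le_mul fun x y => ?_
  rw [NNReal.coe_mul, Real.coe_toNNReal _ (Real.exp_pos M).le, Real.dist_eq, mul_assoc]
  refine abs_le.2 ⟨?_, key x y⟩
  have := key y x
  rw [dist_comm] at this
  linarith

/-- No differentiability is assumed: `exp ∘ f` is differentiable exactly where `f` is, and elsewhere
both gradients take the default value 0. -/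
theorem gradient_exp_comp (f : Plane → ℝ) (x : Plane) :
    gradient (fun y => Real.exp (f y)) x = Real.exp (f x) • gradient f x := by
  by_cases h : DifferentiableAt ℝ f x
  · refine ext_inner_right ℝ fun e => ?_
    rw [inner_gradient_eq_fderiv, inner_smul_left, inner_gradient_eq_fderiv, fderiv_exp h]
    simp
  · have h' : ¬ DifferentiableAt ℝ (fun y => Real.exp (f y)) x := by
      intro h1
      have := h1.log (Real.exp_ne_zero _)
      simp only [Real.log_exp] at this
      exact h this
    rw [gradient, gradient, fderiv_zero_of_not_differentiableAt h,
      fderiv_zero_of_not_differentiableAt h', map_zero, smul_zero]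

/-! ### The Agmon weight -/

section Weight

theorem cot_pos {a : ℝ} (ha : a ∈ Ioo 0 (Real.pi / 2)) : 0 < Real.cot a := by
  rw [Real.cot_eq_cos_div_sin]
  exact div_pos (Real.cos_pos_of_mem_Ioo ⟨by linarith [ha.1, Real.pi_pos], ha.2⟩)
    (Real.sin_pos_of_pos_of_lt_pi ha.1 (by linarith [ha.2, Real.pi_pos]))

theorem cot_le_cot {a b : ℝ} (ha : a ∈ Ioo 0 (Real.pi / 2)) (hb : b ∈ Ioo 0 (Real.pi / 2))
    (hab : a ≤ b) : Real.cot b ≤ Real.cot a := by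
  have hpi := Real.pi_pos
  rw [Real.cot_eq_cos_div_sin, Real.cot_eq_cos_div_sin]
  refine div_le_div₀ (Real.cos_pos_of_mem_Ioo ⟨by linarith [ha.1], ha.2⟩).le ?_
    (Real.sin_pos_of_pos_of_lt_pi ha.1 (by linarith [ha.2])) ?_
  · exact Real.cos_le_cos_of_nonneg_of_le_pi ha.1.le (by linarith [hb.2]) hab
  · exact Real.sin_le_sin_of_le_of_le_pi_div_two (by linarith [ha.1]) hb.2.le hab

variable {N : ℕ} {B : Fin N → Plane} {α : Fin N → ℝ} {β b L κ : ℝ}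

theorem lipschitzWith_agmonWeight (hN : 0 < N) (hβ : 0 ≤ β) (hα : ∀ j, 0 ≤ Real.cot (α j))
    (hκ : ∀ j, Real.cot (α j) ≤ κ) :
    LipschitzWith (Real.toNNReal (β * κ)) (agmonWeight B α β b L) := by
  have : Nonempty (Fin N) := ⟨⟨0, hN⟩⟩
  have hκ0 : 0 ≤ κ := (hα ⟨0, hN⟩).trans (hκ _)
  refine LipschitzWith.of_le_add_mul _ fun x y => ?_
  rw [Real.coe_toNNReal _ (mul_nonneg hβ hκ0), agmonWeight, agmonWeight, mul_assoc, ← mul_add]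
  refine mul_le_mul_of_nonneg_left ?_ hβ
  have hd : 0 ≤ κ * dist x y := mul_nonneg hκ0 dist_nonneg
  have h1 : (⨅ j, Real.cot (α j) * ‖x - L • B j‖) ≤
      (⨅ j, Real.cot (α j) * ‖y - L • B j‖) + κ * dist x y := by
    rw [← sub_le_iff_le_add]
    refine le_ciInf fun j => ?_
    rw [sub_le_iff_le_add]
    refine (ciInf_le (Finite.bddBelow_range _) j).trans ?_
    have h2 : ‖x - L • B j‖ ≤ ‖y - L • B j‖ + dist x y := by
      have : x - L • B j = (y - L • B j) + (x - y) := by abel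
      rw [this, dist_eq_norm]
      exact norm_add_le _ _
    calc _ ≤ Real.cot (α j) * (‖y - L • B j‖ + dist x y) :=
          mul_le_mul_of_nonneg_left h2 (hα j)
      _ = Real.cot (α j) * ‖y - L • B j‖ + Real.cot (α j) * dist x y := mul_add _ _ _
      _ ≤ _ := by
        gcongr
        exact hκ j
  rw [← min_add_add_right]
  exact min_le_min h1 (by linarith)

theorem agmonWeight_le_of_near (hβ : 0 ≤ β) (hα : ∀ j, 0 ≤ Real.cot (α j))
    (hκ : ∀ j, Real.cot (α j) ≤ κ) {x : Plane} {r : ℝ} {j : Fin N} (hx : ‖x - L • B j‖ ≤ r) :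
    agmonWeight B α β b L x ≤ β * (κ * r) := by
  refine mul_le_mul_of_nonneg_left ((min_le_left _ _).trans ?_) hβ
  refine (ciInf_le (Finite.bddBelow_range _) j).trans ?_
  exact mul_le_mul (hκ j) hx (norm_nonneg _) ((hα j).trans (hκ j))

end Weight

/-! ### Agmon identity and weighted estimates -/

/-- The Agmon identity for the Robin form. -/
theorem agmon_identity {Ω : Set Plane} {β E : ℝ} {u : Plane → ℝ} {G : Plane → Plane}
    {g : Plane → ℝ} (h : HasTrace Ω u G g)
    (heq : ∀ (v : Plane → ℝ) (G' : Plane → Plane) (g' : Plane → ℝ), HasTrace Ω v G' g' →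
      robinForm Ω β G g G' g' = ∫ x in Ω, (E * u x) * v x)
    {F : Plane → ℝ} (hF : ContDiff ℝ ∞ F) {K : NNReal} (hK : LipschitzWith K F) {M : ℝ}
    (hM : ∀ x, F x ≤ M) :
    (∫ x in Ω, ‖Real.exp (F x) • G x + u x • gradient (fun y => Real.exp (F y)) x‖ ^ 2) -
      β * ∫ x, (Real.exp (F x) * g x) ^ 2 ∂(boundaryMeasure Ω) =
      ∫ x in Ω, (E + ‖gradient F x‖ ^ 2) * (Real.exp (F x) * u x) ^ 2 := by
  have hζ := lipschitzWith_exp_comp hK hM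
  have hζs : ContDiff ℝ ∞ fun x => Real.exp (F x) := hF.exp
  have hζb : ∀ x, |Real.exp (F x)| ≤ Real.exp M := fun x => by
    rw [Real.abs_exp]; exact Real.exp_le_exp.2 (hM x)
  have hw := h.mul_smooth hζs hζ hζb
  -- Multiplying twice by `e^F` produces the test function `e^{2F} u` together with its trace.
  have hv := hw.mul_smooth hζs hζ hζb
  have key := heq _ _ _ hv
  have hgK : ∀ x, ‖gradient F x‖ ≤ K := fun x => by
    rw [norm_gradient_eq]; exact norm_fderiv_le_of_lipschitz ℝ hK
  have iw : Integrable (fun x => (Real.exp (F x) * u x) ^ 2) (volume.restrict Ω) :=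
    hw.weakGradient.memLp_fun.integrable_sq
  have iF : Integrable (fun x => ‖gradient F x‖ ^ 2 * (Real.exp (F x) * u x) ^ 2)
      (volume.restrict Ω) :=
    iw.bdd_mul (c := K ^ 2) ((measurable_gradient F).norm.pow_const 2).aestronglyMeasurable
      (Eventually.of_forall fun x => by
        rw [norm_pow, norm_norm]; exact pow_le_pow_left₀ (norm_nonneg _) (hgK x) 2)
  have iG := integrable_inner_of_memLp h.weakGradient.memLp_grad hv.weakGradient.memLp_grad
  -- In |∇(e^F u)|² = ∇u · ∇(e^{2F} u) + |∇F|² e^{2F} u² the cross terms agree on both sides.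
  have e1 : ∀ x, ‖Real.exp (F x) • G x + u x • gradient (fun y => Real.exp (F y)) x‖ ^ 2 =
      inner ℝ (G x) (Real.exp (F x) • (Real.exp (F x) • G x +
        u x • gradient (fun y => Real.exp (F y)) x) +
        (Real.exp (F x) * u x) • gradient (fun y => Real.exp (F y)) x) +
      ‖gradient F x‖ ^ 2 * (Real.exp (F x) * u x) ^ 2 := by
    intro x
    rw [gradient_exp_comp, ← real_inner_self_eq_norm_sq, ← real_inner_self_eq_norm_sq]
    simp only [inner_add_left, inner_add_right, inner_smul_left, inner_smul_right,
      RCLike.conj_to_real]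
    rw [real_inner_comm (G x) (gradient F x)]
    ring
  rw [integral_congr_ae (Eventually.of_forall e1), integral_add iG iF]
  have e2 : ∀ x, (E + ‖gradient F x‖ ^ 2) * (Real.exp (F x) * u x) ^ 2 =
      (E * u x) * (Real.exp (F x) * (Real.exp (F x) * u x)) +
        ‖gradient F x‖ ^ 2 * (Real.exp (F x) * u x) ^ 2 := fun x => by ring
  have iE : Integrable (fun x => (E * u x) * (Real.exp (F x) * (Real.exp (F x) * u x)))
      (volume.restrict Ω) := by
    refine (iw.const_mul E).congr (Eventually.of_forall fun x => ?_)
    simp only []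
    ring
  rw [integral_congr_ae (Eventually.of_forall e2), integral_add iE iF, ← key, robinForm]
  have e3 : ∀ x, (Real.exp (F x) * g x) ^ 2 =
      g x * (Real.exp (F x) * (Real.exp (F x) * g x)) := fun x => by ring
  simp_rw [e3]
  ring

/-- The weighted estimate for an eigenfunction, given the bounds for the Robin form. -/
theorem weighted_estimate {Ω S : Set Plane} (hS : MeasurableSet S)
    {β E : ℝ} {u : Plane → ℝ} {G : Plane → Plane} {g : Plane → ℝ} (h : HasTrace Ω u G g)
    (heq : ∀ (v : Plane → ℝ) (G' : Plane → Plane) (g' : Plane → ℝ), HasTrace Ω v G' g' →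
      robinForm Ω β G g G' g' = ∫ x in Ω, (E * u x) * v x)
    (hu1 : ∫ x in Ω, u x ^ 2 = 1) {C a c₁ T : ℝ} (hC : 0 ≤ C) (hc₁ : 0 < c₁)
    (hb : ∀ (w : Plane → ℝ) (G' : Plane → Plane) (g' : Plane → ℝ), HasTrace Ω w G' g' →
      (β * ∫ x, g' x ^ 2 ∂(boundaryMeasure Ω) ≤ (∫ x in Ω, ‖G' x‖ ^ 2) +
        ∫ x in Ω, (a + S.indicator (fun _ => C) x) * w x ^ 2) ∧
      (β * ∫ x, g' x ^ 2 ∂(boundaryMeasure Ω) ≤ 1 / 2 * (∫ x in Ω, ‖G' x‖ ^ 2) +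
        ∫ x in Ω, (2 * C) * w x ^ 2))
    {F : Plane → ℝ} (hF : ContDiff ℝ ∞ F) {K : NNReal} (hK : LipschitzWith K F) {M : ℝ}
    (hM : ∀ x, F x ≤ M) (hE : E + K ^ 2 ≤ 0) (hEa : E + K ^ 2 + a ≤ -c₁)
    (hT : ∀ x ∈ S, F x ≤ T) :
    (∫ x in Ω, (Real.exp (F x) * u x) ^ 2 ≤ C / c₁ * Real.exp T ^ 2) ∧
    (∫ x in Ω, ‖Real.exp (F x) • G x + u x • gradient (fun y => Real.exp (F y)) x‖ ^ 2 ≤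
      4 * C * (C / c₁ * Real.exp T ^ 2)) := by
  have hid := agmon_identity h heq hF hK hM
  have hw := h.mul_smooth hF.exp (lipschitzWith_exp_comp hK hM) (C := Real.exp M) (fun x => by
    rw [Real.abs_exp]; exact Real.exp_le_exp.2 (hM x))
  obtain ⟨b1, b2⟩ := hb _ _ _ hw
  have hgK : ∀ x, ‖gradient F x‖ ^ 2 ≤ K ^ 2 := fun x => by
    refine pow_le_pow_left₀ (norm_nonneg _) ?_ 2
    rw [norm_gradient_eq]; exact norm_fderiv_le_of_lipschitz ℝ hK
  set w : Plane → ℝ := fun x => Real.exp (F x) * u x with hwd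
  have iw : Integrable (fun x => w x ^ 2) (volume.restrict Ω) :=
    hw.weakGradient.memLp_fun.integrable_sq
  have iu : Integrable (fun x => u x ^ 2) (volume.restrict Ω) :=
    h.weakGradient.memLp_fun.integrable_sq
  have iF : Integrable (fun x => (E + ‖gradient F x‖ ^ 2) * w x ^ 2) (volume.restrict Ω) :=
    iw.bdd_mul (c := |E| + K ^ 2)
      (measurable_const.add ((measurable_gradient F).norm.pow_const 2)).aestronglyMeasurable
      (Eventually.of_forall fun x => by
        refine (norm_add_le _ _).trans (add_le_add le_rfl ?_)
        rw [norm_pow, norm_norm]; exact hgK x)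
  have iS : Integrable (fun x => (a + S.indicator (fun _ => C) x) * w x ^ 2)
      (volume.restrict Ω) := by
    refine iw.bdd_mul (c := |a| + C)
      (measurable_const.add (measurable_const.indicator hS)).aestronglyMeasurable
      (Eventually.of_forall fun x => ?_)
    refine (norm_add_le _ _).trans (add_le_add le_rfl ?_)
    refine (norm_indicator_le_norm_self _ _).trans ?_
    exact (Real.norm_of_nonneg hC).le
  -- The identity evaluates the form at `w` and `b1` bounds it below; in their sum the gradient and
  -- boundary terms cancel.
  have h1 : 0 ≤ ∫ x in Ω, ((E + ‖gradient F x‖ ^ 2) * w x ^ 2 +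
      (a + S.indicator (fun _ => C) x) * w x ^ 2) := by
    rw [integral_add iF iS]
    linarith
  have h2 : ∫ x in Ω, ((E + ‖gradient F x‖ ^ 2) * w x ^ 2 +
      (a + S.indicator (fun _ => C) x) * w x ^ 2) ≤
      ∫ x in Ω, (-c₁ * w x ^ 2 + C * Real.exp T ^ 2 * u x ^ 2) := by
    refine integral_mono (iF.add iS) ((iw.const_mul _).add (iu.const_mul _)) fun x => ?_
    have h3 := hgK x
    -- On `S` the weight is at most `e^T`, so the loss there is controlled by the normalization of
    -- `u`.
    have h4 : S.indicator (fun _ => C) x * w x ^ 2 ≤ C * Real.exp T ^ 2 * u x ^ 2 := by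
      by_cases hx : x ∈ S
      · rw [indicator_of_mem hx, mul_assoc]
        refine mul_le_mul_of_nonneg_left ?_ hC
        simp only [hwd, mul_pow]
        gcongr
        exact hT x hx
      · rw [indicator_of_notMem hx, zero_mul]
        positivity
    have h5 : (E + ‖gradient F x‖ ^ 2 + a) * w x ^ 2 ≤ -c₁ * w x ^ 2 :=
      mul_le_mul_of_nonneg_right (by linarith) (sq_nonneg _)
    simp only []
    linarith
  rw [integral_add (iw.const_mul _) (iu.const_mul _), integral_const_mul, integral_const_mul,
    hu1] at h2
  have hw2 : ∫ x in Ω, w x ^ 2 ≤ C / c₁ * Real.exp T ^ 2 := by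
    rw [div_mul_eq_mul_div, le_div_iff₀ hc₁]
    linarith
  refine ⟨hw2, ?_⟩
  -- The form at `w` is thus nonpositive, so `b2` absorbs half of the Dirichlet integral and bounds
  -- it by `4 * C` times ∫ w².
  have h6 : ∫ x in Ω, (E + ‖gradient F x‖ ^ 2) * w x ^ 2 ≤ 0 :=
    integral_nonpos fun x => mul_nonpos_of_nonpos_of_nonneg (by linarith [hgK x]) (sq_nonneg _)
  rw [integral_const_mul] at b2
  have h7 := mul_le_mul_of_nonneg_left hw2 (by positivity : 0 ≤ 4 * C)
  linarith

/-- Transfer of the weighted estimate to a nearby Lipschitz weight. -/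
theorem h1Norm_exp_mul_le {Ω : Set Plane} {u : Plane → ℝ} {G : Plane → Plane} {g : Plane → ℝ}
    (h : HasTrace Ω u G g) {F F' : Plane → ℝ} {K : NNReal} (hF : ContDiff ℝ ∞ F)
    (hK : LipschitzWith K F) (hK' : LipschitzWith K F') {M : ℝ} (hM : ∀ x, F x ≤ M)
    (hM' : ∀ x, F' x ≤ M) (hnear : ∀ x, F' x ≤ F x + 1) {A A' : ℝ}
    (hA : ∫ x in Ω, (Real.exp (F x) * u x) ^ 2 ≤ A)
    (hA' : ∫ x in Ω, ‖Real.exp (F x) • G x + u x • gradient (fun y => Real.exp (F y)) x‖ ^ 2 ≤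
      A') :
    ∃ G' : Plane → Plane, HasWeakGradient Ω (fun x => Real.exp (F' x) * u x) G' ∧
      h1Norm Ω (fun x => Real.exp (F' x) * u x) G' ≤
        Real.sqrt (Real.exp 1 ^ 2 * (2 * A' + (8 * K ^ 2 + 1) * A)) := by
  have hw := h.mul_smooth hF.exp (lipschitzWith_exp_comp hK hM) (C := Real.exp M) (fun x => by
    rw [Real.abs_exp]; exact Real.exp_le_exp.2 (hM x))
  have hw' := h.weakGradient_mul (lipschitzWith_exp_comp hK' hM') (C := Real.exp M) (fun x => by
    rw [Real.abs_exp]; exact Real.exp_le_exp.2 (hM' x))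
  refine ⟨_, hw', Real.sqrt_le_sqrt ?_⟩
  have i1 : Integrable (fun x => (Real.exp (F x) * u x) ^ 2) (volume.restrict Ω) :=
    hw.weakGradient.memLp_fun.integrable_sq
  have i2 := hw.weakGradient.memLp_grad.integrable_norm_pow (by norm_num)
  have i3 : Integrable (fun x => (Real.exp (F' x) * u x) ^ 2) (volume.restrict Ω) :=
    hw'.memLp_fun.integrable_sq
  have i4 := hw'.memLp_grad.integrable_norm_pow (by norm_num)
  have hexp : ∀ x, Real.exp (F' x) ≤ Real.exp 1 * Real.exp (F x) := fun x => by
    rw [← Real.exp_add]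
    exact Real.exp_le_exp.2 (by linarith [hnear x])
  have hg : ∀ {f : Plane → ℝ}, LipschitzWith K f → ∀ x, ‖gradient f x‖ ≤ K := fun hf x => by
    rw [norm_gradient_eq]; exact norm_fderiv_le_of_lipschitz ℝ hf
  have p1 : ∀ x, (Real.exp (F' x) * u x) ^ 2 ≤
      Real.exp 1 ^ 2 * (Real.exp (F x) * u x) ^ 2 := fun x => by
    calc (Real.exp (F' x) * u x) ^ 2 = Real.exp (F' x) ^ 2 * u x ^ 2 := mul_pow _ _ _
      _ ≤ (Real.exp 1 * Real.exp (F x)) ^ 2 * u x ^ 2 := by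
        gcongr
        exact hexp x
      _ = _ := by ring
  have p2 : ∀ x, ‖Real.exp (F' x) • G x + u x • gradient (fun y => Real.exp (F' y)) x‖ ^ 2 ≤
      Real.exp 1 ^ 2 * (2 * ‖Real.exp (F x) • G x +
        u x • gradient (fun y => Real.exp (F y)) x‖ ^ 2 +
        8 * K ^ 2 * (Real.exp (F x) * u x) ^ 2) := by
    intro x
    rw [gradient_exp_comp, gradient_exp_comp]
    set e := Real.exp (F x) with he
    have he0 : 0 < e := Real.exp_pos _
    set W := e • G x + u x • e • gradient F x with hW
    -- Undo the product rule for `F`, then apply it for `F'`: each costs one term `K * |e * u x|`.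
    -- Then (a + 2b)² ≤ 2a² + 8b² yields the constants 2 and 8.
    have s1 : ‖e • G x‖ ≤ ‖W‖ + K * |e * u x| := by
      have : e • G x = W - (e * u x) • gradient F x := by
        rw [hW, smul_smul, mul_comm (u x)]; abel
      rw [this]
      refine (norm_sub_le _ _).trans (add_le_add le_rfl ?_)
      rw [norm_smul, Real.norm_eq_abs, mul_comm]
      exact mul_le_mul_of_nonneg_right (hg hK x) (abs_nonneg _)
    have s2 : ‖Real.exp (F' x) • G x + u x • Real.exp (F' x) • gradient F' x‖ ≤
        Real.exp 1 * (‖W‖ + 2 * (K * |e * u x|)) := by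
      rw [smul_comm (u x), ← smul_add, norm_smul, Real.norm_of_nonneg (Real.exp_pos _).le]
      calc Real.exp (F' x) * ‖G x + u x • gradient F' x‖
          ≤ Real.exp 1 * e * (‖G x‖ + K * |u x|) := by
            refine mul_le_mul (hexp x) ((norm_add_le _ _).trans (add_le_add le_rfl ?_))
              (norm_nonneg _) (by positivity)
            rw [norm_smul, Real.norm_eq_abs, mul_comm]
            exact mul_le_mul_of_nonneg_right (hg hK' x) (abs_nonneg _)
        _ = Real.exp 1 * (‖e • G x‖ + K * |e * u x|) := by
            rw [norm_smul, abs_mul, Real.norm_of_nonneg he0.le, abs_of_pos he0]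
            ring
        _ ≤ _ := by
            refine mul_le_mul_of_nonneg_left ?_ (Real.exp_pos 1).le
            linarith
    calc _ ≤ (Real.exp 1 * (‖W‖ + 2 * (K * |e * u x|))) ^ 2 :=
          pow_le_pow_left₀ (norm_nonneg _) s2 2
      _ ≤ _ := by
        rw [mul_pow]
        refine mul_le_mul_of_nonneg_left ?_ (by positivity)
        rw [← sq_abs (e * u x)]
        nlinarith [sq_nonneg (‖W‖ - 2 * (K * |e * u x|))]
  have q1 : ∫ x in Ω, (Real.exp (F' x) * u x) ^ 2 ≤ Real.exp 1 ^ 2 * A := by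
    refine (integral_mono i3 (i1.const_mul _) p1).trans ?_
    rw [integral_const_mul]
    gcongr
  have q2 := integral_mono i4 (((i2.const_mul 2).add (i1.const_mul (8 * (K : ℝ) ^ 2))).const_mul
    (Real.exp 1 ^ 2)) p2
  have q3 : ∫ x in Ω, Real.exp 1 ^ 2 * (2 * ‖Real.exp (F x) • G x +
        u x • gradient (fun y => Real.exp (F y)) x‖ ^ 2 +
        8 * K ^ 2 * (Real.exp (F x) * u x) ^ 2) ≤
      Real.exp 1 ^ 2 * (2 * A' + 8 * K ^ 2 * A) := by
    rw [integral_const_mul, integral_add (i2.const_mul 2) (i1.const_mul _), integral_const_mul,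
      integral_const_mul]
    gcongr
  calc _ ≤ Real.exp 1 ^ 2 * (2 * A' + 8 * K ^ 2 * A) + Real.exp 1 ^ 2 * A :=
        add_le_add (q2.trans q3) q1
    _ = _ := by ring

end RobinPolygon

/-! ### Choice of constants and conclusion -/

theorem mainTheorem2
    (Ω₁ : Set RobinPolygon.Plane) (hΩ₁ : RobinPolygon.IsConvexPolygonalDomain Ω₁)
    (N : ℕ) (hN : 0 < N)
    (B : Fin N → RobinPolygon.Plane) (hB : Function.Injective B)
    (hvert : Set.range B = RobinPolygon.vertices Ω₁)
    (α : Fin N → ℝ) (hα : ∀ j, α j ∈ Set.Ioo 0 (Real.pi / 2))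
    (hcorner : ∀ j, RobinPolygon.HasCorner Ω₁ (B j) (α j))
    (β : ℝ) (hβ : 0 < β)
    (b : ℝ) (hb : 0 < b) (hbB : ∀ j, B j ∈ Metric.closedBall (0 : RobinPolygon.Plane) b)
    (lam : ℝ → ℝ) (hlam : ∀ L : ℝ, 0 < L → 0 < lam L)
    (hlim : Filter.Tendsto lam Filter.atTop (nhds 0)) :
    ∀ ε ∈ Set.Ioo (0 : ℝ) 1, ∃ C > (0 : ℝ), ∃ L₀ > (0 : ℝ), ∀ L ≥ L₀,
      ∀ (E : ℝ) (u : RobinPolygon.Plane → ℝ),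
        E ≤ -(β ^ 2 / Real.sin (⨅ j, α j) ^ 2) + lam L →
        RobinPolygon.IsNormalizedEigenfunction (L • Ω₁) β E u →
        ∃ G : RobinPolygon.Plane → RobinPolygon.Plane,
          RobinPolygon.HasWeakGradient (L • Ω₁)
            (fun x => Real.exp ((1 - ε) * RobinPolygon.agmonWeight B α β b L x) * u x) G ∧
          RobinPolygon.h1Norm (L • Ω₁)
            (fun x => Real.exp ((1 - ε) * RobinPolygon.agmonWeight B α β b L x) * u x) G ≤
            C * Real.exp (ε * L) := by
  classical
  intro ε hε
  obtain ⟨ι, _, n, c, hn, hinj, hne, rfl⟩ :=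
    RobinPolygon.exists_polygon_of_isConvexPolygonalDomain hΩ₁
  have : Nonempty (Fin N) := ⟨⟨0, hN⟩⟩
  obtain ⟨j₀, hj₀⟩ := exists_eq_ciInf_of_finite (f := α)
  rw [← hj₀]
  have hmin : ∀ j, α j₀ ≤ α j := fun j => by
    rw [hj₀]; exact ciInf_le (Finite.bddBelow_range _) j
  set κ := Real.cot (α j₀) with hκd
  have hκ0 : 0 < κ := RobinPolygon.cot_pos (hα j₀)
  have hcot : ∀ j, Real.cot (α j) ≤ κ := fun j =>
    RobinPolygon.cot_le_cot (hα j₀) (hα j) (hmin j)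
  have hcot0 : ∀ j, 0 ≤ Real.cot (α j) := fun j => (RobinPolygon.cot_pos (hα j)).le
  have hsin : 0 < Real.sin (α j₀) :=
    Real.sin_pos_of_pos_of_lt_pi (hα j₀).1 (by linarith [(hα j₀).2, Real.pi_pos])
  -- The spectral threshold splits into the side energy `β ^ 2` and the square of the largest slope
  -- `β * κ` of Φ.
  have hcs : β ^ 2 / Real.sin (α j₀) ^ 2 = β ^ 2 + (β * κ) ^ 2 := by
    rw [hκd, Real.cot_eq_cos_div_sin]
    field_simp
    linarith [Real.sin_sq_add_cos_sq (α j₀)]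
  have hK0 : 0 < β * κ := mul_pos hβ hκ0
  -- Chosen so that Φ ≤ βκδL = εL on the discs around the vertices.
  set δ := ε / (β * κ) with hδd
  have hδ : 0 < δ := div_pos hε.1 hK0
  have h1ε : 0 < 1 - ε := by linarith [hε.2]
  obtain ⟨C, hC, hbound⟩ :=
    RobinPolygon.exists_robin_bound hn hinj hne hvert hβ.le hδ
  -- The gap gained by the factor `1 - ε` in the weight. Large `L` lets `lam L` and `C / L` use a
  -- quarter each, leaving `c₀ / 2`; `L ≥ 1` gives `C + C / L ≤ 2 * C` for the gradient bound.
  set c₀ : ℝ := (1 - (1 - ε) ^ 2) * (β * κ) ^ 2 with hc₀d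
  have hc₀ : 0 < c₀ := mul_pos (by nlinarith [hε.1, hε.2]) (by positivity)
  set K : NNReal := Real.toNNReal ((1 - ε) * (β * κ)) with hKd
  have hKc : (K : ℝ) = (1 - ε) * (β * κ) := Real.coe_toNNReal _ (by positivity)
  set D : ℝ := 2 * (4 * C * (C / (c₀ / 2))) + (8 * K ^ 2 + 1) * (C / (c₀ / 2)) with hDd
  have hD0 : 0 ≤ D := by positivity
  obtain ⟨L₁, hL₁⟩ := Filter.eventually_atTop.1
    (hlim.eventually_lt_const (by positivity : (0 : ℝ) < c₀ / 4))
  refine ⟨Real.exp 1 ^ 2 * Real.sqrt D + 1, by positivity, max L₁ (max 1 (4 * C / c₀)),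
    by positivity, fun L hL E u hE hu => ?_⟩
  have hLlam : lam L < c₀ / 4 := hL₁ L ((le_max_left _ _).trans hL)
  have hL1 : 1 ≤ L := (le_max_left _ _).trans ((le_max_right _ _).trans hL)
  have hLC : 4 * C / c₀ ≤ L := (le_max_right _ _).trans ((le_max_right _ _).trans hL)
  have hL0 : 0 < L := one_pos.trans_le hL1
  have hCL : C / L ≤ c₀ / 4 := by
    rw [div_le_iff₀ hc₀] at hLC
    rw [div_le_iff₀ hL0]
    linarith
  have hCL1 : C / L ≤ C := div_le_self hC hL1
  obtain ⟨⟨-, G, g, htr, heq⟩, hu1⟩ := hu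
  have hEK : E + (K : ℝ) ^ 2 + β ^ 2 ≤ -c₀ + c₀ / 4 := by
    rw [hcs] at hE
    rw [hKc, mul_pow, hc₀d]
    linarith
  set Φ := RobinPolygon.agmonWeight B α β b L with hΦ
  have hΦK : LipschitzWith (Real.toNNReal (β * κ)) Φ :=
    RobinPolygon.lipschitzWith_agmonWeight hN hβ.le hcot0 hcot
  -- The truncation makes the weight bounded, as multiplication in H¹ requires. The bound depends on
  -- `L` but does not enter the final constants.
  have hΦM : ∀ x, Φ x ≤ β * (b * L) := fun x =>
    mul_le_mul_of_nonneg_left (min_le_right _ _) hβ.le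
  have hscale : ∀ {f : RobinPolygon.Plane → ℝ}, LipschitzWith (Real.toNNReal (β * κ)) f →
      LipschitzWith K fun x => (1 - ε) * f x := by
    intro f hf
    refine LipschitzWith.of_dist_le_mul fun x y => ?_
    have := hf.dist_le_mul x y
    rw [Real.coe_toNNReal _ hK0.le, Real.dist_eq] at this
    rw [hKc, Real.dist_eq, ← mul_sub, abs_mul, abs_of_pos h1ε, mul_assoc]
    exact mul_le_mul_of_nonneg_left this h1ε.le
  obtain ⟨Ψ, hΨs, hΨK, hΨ⟩ := RobinPolygon.exists_contDiff_lipschitzWith_near hΦK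
  have hup : ∀ x, Ψ x ≤ Φ x + 1 := fun x => by linarith [(abs_le.1 (hΨ x)).2]
  have hlow : ∀ x, Φ x ≤ Ψ x + 1 := fun x => by linarith [(abs_le.1 (hΨ x)).1]
  have hM0 : 0 ≤ β * (b * L) + 1 := by positivity
  have hshrink : ∀ {s t : ℝ}, 0 ≤ t → s ≤ t → (1 - ε) * s ≤ t := fun {s t} ht hst =>
    (mul_le_mul_of_nonneg_left hst h1ε.le).trans
      (mul_le_of_le_one_left ht (by linarith [hε.1]))
  have hMΨ : ∀ x, (1 - ε) * Ψ x ≤ β * (b * L) + 1 := fun x =>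
    hshrink hM0 ((hup x).trans (by linarith [hΦM x]))
  have hMΦ : ∀ x, (1 - ε) * Φ x ≤ β * (b * L) + 1 := fun x =>
    hshrink hM0 (by linarith [hΦM x])
  set S : Set RobinPolygon.Plane := {x | ∃ j, ‖x - L • B j‖ ≤ δ * L} with hS
  have hSm : MeasurableSet S := by
    have : S = ⋃ j, {x | ‖x - L • B j‖ ≤ δ * L} := by
      ext x; simp [hS]
    rw [this]
    exact MeasurableSet.iUnion fun j =>
      (isClosed_le (by fun_prop) continuous_const).measurableSet
  have hT : ∀ x ∈ S, (1 - ε) * Ψ x ≤ ε * L + 1 := by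
    rintro x ⟨j, hj⟩
    have h1 : Φ x ≤ β * (κ * (δ * L)) :=
      RobinPolygon.agmonWeight_le_of_near hβ.le hcot0 hcot hj
    have h2 : β * (κ * (δ * L)) = ε * L := by
      rw [hδd]
      field_simp
    have h3 : 0 < ε * L := mul_pos hε.1 hL0
    have h4 := hup x
    exact hshrink (by linarith) (by linarith)
  obtain ⟨hA, hA'⟩ := RobinPolygon.weighted_estimate hSm htr heq hu1 (C := C)
    (a := β ^ 2 + C / L) (c₁ := c₀ / 2) (T := ε * L + 1) hC (by positivity)
    (fun w G' g' hw => by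
      obtain ⟨h1, h2⟩ := hbound L hL0 w G' g' hw
      refine ⟨h1, h2.trans (add_le_add le_rfl ?_)⟩
      have iw := hw.weakGradient.memLp_fun.integrable_sq
      refine integral_mono (iw.const_mul _) (iw.const_mul _) fun x => ?_
      exact mul_le_mul_of_nonneg_right (by linarith) (sq_nonneg _))
    (contDiff_const.mul hΨs) (hscale hΨK) hMΨ (by linarith [sq_nonneg β]) (by linarith) hT
  obtain ⟨G', hG', hnorm⟩ := RobinPolygon.h1Norm_exp_mul_le htr (contDiff_const.mul hΨs)
    (hscale hΨK) (hscale hΦK) hMΨ hMΦ (fun x => by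
      have h1 := hshrink zero_le_one (s := Φ x - Ψ x) (by linarith [hlow x])
      linarith) hA hA'
  refine ⟨G', hG', hnorm.trans ?_⟩
  -- Both bounds carry `exp (ε * L + 1) ^ 2`, so the square root is `exp (ε * L)` times a constant
  -- independent of `L`.
  have hfac : Real.exp 1 ^ 2 * (2 * (4 * C * (C / (c₀ / 2) * Real.exp (ε * L + 1) ^ 2)) +
      (8 * K ^ 2 + 1) * (C / (c₀ / 2) * Real.exp (ε * L + 1) ^ 2)) =
      (Real.exp 1 ^ 2 * Real.exp (ε * L)) ^ 2 * D := by
    rw [Real.exp_add, hDd]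
    ring
  rw [hfac, Real.sqrt_mul (by positivity), Real.sqrt_sq (by positivity)]
  have := Real.exp_pos (ε * L)
  linarith
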